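/- Let $\Gamma$ be a nontrivial finitely generated subgroup of the multiplicative group $\mathbb{Q}^+$ of positive rationals and let $t>0$ be real. Let $\sigma_\Gamma$ be the product of the primes $p$ such that $v_p(g)\neq 0$ for some $g\in\Gamma$. For $k\ge1$ let $\Gamma(k)=\Gamma\cdot{\mathbb{Q}^*}^k/{\mathbb{Q}^*}^k$, let $\mathbb{Q}(\zeta_k,\Gamma^{1/k})$ be the field generated over $\mathbb{Q}$ by the $k$-th roots of unity and all $k$-th roots of the elements of $\Gamma$, let $J_t(k)=k^t\prod_{\ell\mid k}(1-\ell^{-t})$ ($\ell$ prime), let $\operatorname{rad}(k)$ be the product of the distinct primes dividing $k$ and $\omega(k)$ their number. Put $$C_{\Gamma,t}=\sum_{k\ge1}\frac{J_t(k)\,\operatorname{rad}(k)^t\,(-1)^{\omega(k)}}{k^{2t}\,[\mathbb{Q}(\zeta_k,\Gamma^{1/k}):\mathbb{Q}]},\qquad F_p=\sum_{\alpha\ge1}\frac{p^t-1}{p^{\alpha(t+1)-1}\,|\Gamma(p^\alpha)|\,(p-1)}\quad(p\text{ prime}).$$ For a positive squarefree integer $\eta$ let $\delta(\eta)$ be the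 discriminant of the field $\mathbb{Q}(\sqrt\eta)$, let $t_\eta\in\{0,1,2,\dots\}\cup\{\infty\}$ be the least $s\ge0$ with $\eta^{2^s}{\mathbb{Q}^*}^{2^{s+1}}\in\Gamma(2^{s+1})$ (and $\infty$ if there is none), let $\gamma_\eta=\max\{1+t_\eta,\,v_2(\delta(\eta))\}$, and let $$S_\eta=\frac{\sum_{\alpha\ge\gamma_\eta}\frac{2^t-1}{2^{\alpha(t+1)-1}|\Gamma(2^\alpha)|}}{\sum_{\alpha\ge1}\frac{2^t-1}{2^{\alpha(t+1)-1}|\Gamma(2^\alpha)|}}$$ (so $S_\eta=0$ if $\gamma_\eta=\infty$). Then the series $C_{\Gamma,t}$ converges absolutely, for every prime $p$ the series $F_p$ converges and $0<F_p<1$, the product $\prod_p(1-F_p)$ converges, and $$C_{\Gamma,t}=\prod_p(1-F_p)\cdot\Bigl(1+\sum_{\substack{\eta\mid\sigma_\Gamma\\ \eta\ne1}}S_\eta\prod_{p\mid2\eta}\bigl(1-F_p^{-1}\bigr)^{-1}\Bigr),$$ where $\eta$ runs over the positive divisors of $\sigma_\Gamma$ other than $1$ and $p$ over primes. -/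

import Mathlib

noncomputable section

namespace KummerDensity

/-- The set of primes `p` such that `v_p(g) ≠ 0` for some `g ∈ Γ`. -/
def supp (Γ : Subgroup ℚˣ) : Set ℕ :=
  {p | p.Prime ∧ ∃ g ∈ Γ, padicValRat p (g : ℚ) ≠ 0}

/-- `σ_Γ`, the product of the primes in the support of `Γ` (a finite set when `Γ` is finitely
generated). -/
def sigma (Γ : Subgroup ℚˣ) : ℕ := ∏ᶠ p ∈ supp Γ, p

/-- The subgroup `(ℚ^*)^k` of `k`-th powers. -/
abbrev powers (k : ℕ) : Subgroup ℚˣ := (powMonoidHom k : ℚˣ →* ℚˣ).range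

/-- `Γ(k) = Γ · (ℚ^*)^k / (ℚ^*)^k`, the image of `Γ` in `ℚ^* / (ℚ^*)^k`. -/
def GammaMod (Γ : Subgroup ℚˣ) (k : ℕ) : Subgroup (ℚˣ ⧸ powers k) :=
  Γ.map (QuotientGroup.mk' (powers k))

/-- `ℚ(ζ_k, Γ^{1/k})`, the subfield of `ℂ` generated over `ℚ` by the `k`-th roots of unity and all
`k`-th roots of all elements of `Γ`. -/
def kummerField (Γ : Subgroup ℚˣ) (k : ℕ) : IntermediateField ℚ ℂ :=
  IntermediateField.adjoin ℚ
    ({z : ℂ | z ^ k = 1} ∪ {z : ℂ | ∃ g ∈ Γ, z ^ k = ((g : ℚ) : ℂ)})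

/-- Jordan's totient function `J_t(m) = m^t ∏_{ℓ ∣ m} (1 - 1 / ℓ^t)`. -/
def jordan (t : ℝ) (m : ℕ) : ℝ :=
  (m : ℝ) ^ t * ∏ l ∈ m.primeFactors, (1 - 1 / (l : ℝ) ^ t)

/-- The product of the distinct primes dividing `k`. -/
def rad (k : ℕ) : ℕ := ∏ p ∈ k.primeFactors, p

/-- The `k`-th term of the series defining `C_{Γ,t}`. -/
def densityTerm (Γ : Subgroup ℚˣ) (t : ℝ) (k : ℕ+) : ℝ :=
  jordan t k * (rad k : ℝ) ^ t * (-1) ^ (k : ℕ).primeFactors.card /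
    (((k : ℕ) : ℝ) ^ (2 * t) * (Module.finrank ℚ (kummerField Γ k) : ℝ))

/-- `C_{Γ,t}`. -/
def densityConst (Γ : Subgroup ℚˣ) (t : ℝ) : ℝ := ∑' k : ℕ+, densityTerm Γ t k

/-- The field `ℚ(√η)`, as a subfield of `ℂ`. -/
def quadField (η : ℚ) : IntermediateField ℚ ℂ :=
  IntermediateField.adjoin ℚ {x : ℂ | x ^ 2 = (η : ℂ)}

instance quadField_numberField (η : ℚ) : NumberField (quadField η) where
  to_charZero := inferInstance
  to_finiteDimensional := by
    have hfin : Set.Finite {x : ℂ | x ^ 2 = (η : ℂ)} := by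
      refine ((Polynomial.nthRoots 2 (η : ℂ)).toFinset.finite_toSet).subset fun x hx => ?_
      simpa [Polynomial.mem_nthRoots] using hx
    have : Finite {x : ℂ | x ^ 2 = (η : ℂ)} := hfin
    refine IntermediateField.finiteDimensional_adjoin fun x hx => ?_
    refine IsIntegral.of_pow (n := 2) two_pos ?_
    rw [show x ^ 2 = (η : ℂ) from hx]
    exact isIntegral_algebraMap (R := ℚ) (A := ℂ) (x := η)

/-- `δ(η)`, the discriminant of the number field `ℚ(√η)`. -/
def fieldDisc (η : ℚ) : ℤ := NumberField.discr (quadField η)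

/-- The condition `η^{2^s} (ℚ^*)^{2^{s+1}} ∈ Γ(2^{s+1})`. -/
def PowerMem (Γ : Subgroup ℚˣ) (η : ℤ) (s : ℕ) : Prop :=
  ∃ u : ℚˣ, (u : ℚ) = (η : ℚ) ^ 2 ^ s ∧
    QuotientGroup.mk' (powers (2 ^ (s + 1))) u ∈ GammaMod Γ (2 ^ (s + 1))

open Classical in
/-- `t_η`, the least `s ≥ 0` with `η^{2^s} (ℚ^*)^{2^{s+1}} ∈ Γ(2^{s+1})`, and `∞` if there is none. -/
def tExp (Γ : Subgroup ℚˣ) (η : ℤ) : ℕ∞ :=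
  if h : ∃ s, PowerMem Γ η s then ((Nat.find h : ℕ) : ℕ∞) else ⊤

/-- `γ_η = max {1 + t_η, v_2(δ(η))}`. -/
def gammaExp (Γ : Subgroup ℚˣ) (η : ℤ) : ℕ∞ :=
  max (1 + tExp Γ η) ((padicValInt 2 (fieldDisc η) : ℕ) : ℕ∞)

/-- `(p^t - 1) / (p^{α(t+1)-1} |Γ(p^α)| (p - 1))`. -/
def localTerm (Γ : Subgroup ℚˣ) (t : ℝ) (p α : ℕ) : ℝ :=
  ((p : ℝ) ^ t - 1) /
    ((p : ℝ) ^ ((α : ℝ) * (t + 1) - 1) * (Nat.card (GammaMod Γ (p ^ α)) : ℝ) * ((p : ℝ) - 1))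

/-- The sum of `localTerm` over `α ≥ 1`. -/
def localSum (Γ : Subgroup ℚˣ) (t : ℝ) (p : ℕ) : ℝ :=
  ∑' α : {α : ℕ // 1 ≤ α}, localTerm Γ t p α

/-- `(2^t - 1) / (2^{α(t+1)-1} |Γ(2^α)|)`. -/
def twoTerm (Γ : Subgroup ℚˣ) (t : ℝ) (α : ℕ) : ℝ :=
  ((2 : ℝ) ^ t - 1) /
    ((2 : ℝ) ^ ((α : ℝ) * (t + 1) - 1) * (Nat.card (GammaMod Γ (2 ^ α)) : ℝ))

/-- `S_η`. -/
def S (Γ : Subgroup ℚˣ) (t : ℝ) (η : ℤ) : ℝ :=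
  (∑' α : {α : ℕ // gammaExp Γ η ≤ (α : ℕ∞)}, twoTerm Γ t α) /
    (∑' α : {α : ℕ // 1 ≤ α}, twoTerm Γ t α)

end KummerDensity

end

/-! Over `cyc k` $=\mathbb{Q}(\zeta_k)$ Kummer theory gives
$[\mathbb{Q}(\zeta_k,\Gamma^{1/k}):\mathbb{Q}]=\varphi(k)\,|\Gamma(k)|/|E_k|$, where
$E_k\subseteq\Gamma(k)$ is the group of classes of elements of $\Gamma$ that become $k$-th powers in
$\mathbb{Q}(\zeta_k)$ (`finrank_mul_card`).

The group $E_k$ is small because $\mathbb{Q}(\zeta_k)$ is abelian. All conjugates of a real element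
of it are real, so if its $k$-th power is rational, then its square is rational
(`exists_rat_eq_sq`). Hence $E_k=1$ for odd $k$. For $k=2l$ it consists of the classes of $\eta^l$
with $\eta$ squarefree, $\eta^l\in\Gamma\cdot{\mathbb{Q}^*}^{2l}$ and
$\sqrt\eta\in\mathbb{Q}(\zeta_k)$. The first condition depends only on $v_2(l)$ and reads $t_\eta\le
v_2(l)$; the second says $\delta(\eta)\mid k$. So $|E_k|$ counts $\eta=1$ together with the divisors
$\eta\ne1$ of $\sigma_\Gamma$ such that $v_2(k)\ge\gamma_\eta$ and every prime dividing $2\eta$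
divides $k$ (`finrank_kummerField_mul_card`).

The $k$-th term of $C_{\Gamma,t}$ is therefore $f(k)|E_k|$, where $f$ (`genericTerm`) is
multiplicative and $\sum_\alpha f(p^\alpha)=1-F_p$. Exchanging sums, $\eta=1$ contributes
$\prod_p(1-F_p)$. Any other $\eta$ contributes the same product with the factor at each $p\mid2\eta$
replaced by a tail: $-F_p$ for odd $p$, $-S_\eta F_2$ for $p=2$ (`tsum_mul_prod_ite`). Since
$-F_p/(1-F_p)=(1-F_p^{-1})^{-1}$, the formula follows. Absolute convergence holds because
$|\Gamma(k)|\gg k$ and $\varphi(k)\gg\sqrt k$. -/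

noncomputable section
namespace KummerDensity

/-! ### Quadratic subfields of cyclotomic fields. -/

open IntermediateField NumberField

/-- The cyclotomic field `ℚ(ζ_n)` inside `ℂ`. -/
def cyc (n : ℕ) : IntermediateField ℚ ℂ := adjoin ℚ {z : ℂ | z ^ n = 1}

theorem mem_cyc_of_pow_eq_one {n : ℕ} {z : ℂ} (hz : z ^ n = 1) : z ∈ cyc n :=
  subset_adjoin _ _ hz

theorem cyc_mono {m n : ℕ} (h : m ∣ n) : cyc m ≤ cyc n := by
  obtain ⟨c, rfl⟩ := h
  refine adjoin.mono _ _ _ fun z (hz : z ^ m = 1) => ?_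
  simp [pow_mul, hz]

instance isCyclotomicExtension_cyc (n : ℕ) [NeZero n] : IsCyclotomicExtension {n} ℚ (cyc n) := by
  have h := IntermediateField.isCyclotomicExtension_adjoin_of_exists_isPrimitiveRoot
    (S := {n}) (K := ℚ) (L := ℂ) (fun m hm hm0 => ⟨_, Complex.isPrimitiveRoot_exp m hm0⟩)
  have e : {b : ℂ | ∃ m ∈ ({n} : Set ℕ), m ≠ 0 ∧ b ^ m = 1} = {z : ℂ | z ^ n = 1} := by
    ext z; simp [NeZero.ne n]
  rwa [e] at h

instance numberField_cyc (n : ℕ) [NeZero n] : NumberField (cyc n) :=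
  IsCyclotomicExtension.numberField {n} ℚ (cyc n)

theorem finrank_cyc (n : ℕ) [NeZero n] : Module.finrank ℚ (cyc n) = n.totient :=
  IsCyclotomicExtension.Rat.finrank n (cyc n)

theorem dvd_of_isPrimitiveRoot_mem_cyc {m n : ℕ} [NeZero n] [NeZero m] (hn : Even n) {z : ℂ}
    (hz : IsPrimitiveRoot z m) (hmem : z ∈ cyc n) : m ∣ n := by
  have h : IsPrimitiveRoot (⟨z, hmem⟩ : cyc n) m :=
    IsPrimitiveRoot.of_map_of_injective (f := (cyc n).val) hz (cyc n).val.injective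
  have := NumberField.Units.dvd_torsionOrder_of_isPrimitiveRoot h
  rwa [IsCyclotomicExtension.Rat.torsionOrder_eq (n := n), if_pos hn] at this

theorem exists_aut_cyc {n a : ℕ} [NeZero n] (ha : a.Coprime n) :
    ∃ σ : cyc n ≃ₐ[ℚ] cyc n, ∀ z : cyc n, z ^ n = 1 → σ z = z ^ a := by
  refine ⟨(IsCyclotomicExtension.Rat.galEquivZMod n (cyc n)).symm (ZMod.unitOfCoprime a ha),
    fun z hz => ?_⟩
  rw [IsCyclotomicExtension.Rat.galEquivZMod_apply_of_pow_eq n (cyc n) _ hz,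
    MulEquiv.apply_symm_apply, ZMod.coe_unitOfCoprime, ZMod.val_natCast]
  exact (pow_eq_pow_mod a hz).symm

/-- Such a $\sigma$ fixes the $m$-th roots of unity, which generate `cyc m`. The induction carries
membership in `cyc n` along so that $\sigma$ can be applied. -/
theorem aut_apply_of_mem_cyc {m n a : ℕ} (σ : cyc n ≃ₐ[ℚ] cyc n)
    (hσ : ∀ z : cyc n, z ^ n = 1 → σ z = z ^ a) (hmn : m ∣ n) (ham : a ≡ 1 [MOD m])
    (x : cyc n) (hx : (x : ℂ) ∈ cyc m) : σ x = x := by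
  suffices h : ∀ z ∈ cyc m, ∃ hz : z ∈ cyc n, σ ⟨z, hz⟩ = ⟨z, hz⟩ from (h x hx).2
  intro z hz
  induction hz using IntermediateField.adjoin_induction with
  | mem z hz =>
    have hz : z ^ m = 1 := hz
    have hzn : z ∈ cyc n := cyc_mono hmn (mem_cyc_of_pow_eq_one hz)
    refine ⟨hzn, ?_⟩
    obtain ⟨c, rfl⟩ := hmn
    have hzm : (⟨z, hzn⟩ : cyc (m * c)) ^ m = 1 := Subtype.ext hz
    rw [hσ _ (by rw [pow_mul, hzm, one_pow]), pow_eq_pow_mod a hzm, ham,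
      ← pow_eq_pow_mod 1 hzm, pow_one]
  | algebraMap q => exact ⟨(cyc n).algebraMap_mem q, σ.commutes q⟩
  | add y z _ _ hy hz =>
    obtain ⟨hy, ey⟩ := hy
    obtain ⟨hz, ez⟩ := hz
    exact ⟨add_mem hy hz, (map_add σ ⟨y, hy⟩ ⟨z, hz⟩).trans (by rw [ey, ez]; rfl)⟩
  | mul y z _ _ hy hz =>
    obtain ⟨hy, ey⟩ := hy
    obtain ⟨hz, ez⟩ := hz
    exact ⟨mul_mem hy hz, (map_mul σ ⟨y, hy⟩ ⟨z, hz⟩).trans (by rw [ey, ez]; rfl)⟩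
  | inv z _ hz =>
    obtain ⟨hz, ez⟩ := hz
    exact ⟨inv_mem hz, (map_inv₀ σ ⟨z, hz⟩).trans (by rw [ez]; rfl)⟩

/-- The quadratic Gauss sum modulo `p`, in `ℂ`. -/
def quadGauss (p : ℕ) [Fact p.Prime] : ℂ :=
  gaussSum ((quadraticChar (ZMod p)).ringHomComp (Int.castRingHom ℂ)) (ZMod.stdAddChar (N := p))

theorem quadGauss_sq (p : ℕ) [Fact p.Prime] (hp : p ≠ 2) :
    quadGauss p ^ 2 = ((ZMod.χ₄ p * p : ℤ) : ℂ) := by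
  have hc : ringChar (ZMod p) ≠ 2 := by rwa [ZMod.ringChar_zmod_n]
  have h1 : (quadraticChar (ZMod p)).ringHomComp (Int.castRingHom ℂ) ≠ 1 :=
    (MulChar.ringHomComp_ne_one_iff (RingHom.injective_int _)).mpr (quadraticChar_ne_one hc)
  rw [quadGauss, gaussSum_sq h1 ((quadraticChar_isQuadratic _).comp _)
    (ZMod.isPrimitive_stdAddChar p)]
  simp [quadraticChar_neg_one hc]

theorem stdAddChar_pow_eq_one (p : ℕ) [NeZero p] (x : ZMod p) :
    ZMod.stdAddChar x ^ p = (1 : ℂ) := by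
  rw [← AddChar.map_nsmul_eq_pow]
  simp

theorem quadGauss_mem (p : ℕ) [Fact p.Prime] : quadGauss p ∈ cyc p := by
  refine sum_mem fun x _ => mul_mem ?_ (mem_cyc_of_pow_eq_one (stdAddChar_pow_eq_one p x))
  simp

/-- $\sigma$ replaces $\psi(x)$ by $\psi(ax)$; reindexing the sum by $x\mapsto ax$ pulls out
$\chi(a)=-1$. -/
theorem aut_quadGauss {n p a : ℕ} [Fact p.Prime] (σ : cyc n ≃ₐ[ℚ] cyc n)
    (hσ : ∀ z : cyc n, z ^ n = 1 → σ z = z ^ a) (hpn : p ∣ n)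
    (ha : quadraticChar (ZMod p) a = -1) (h : quadGauss p ∈ cyc n) :
    σ ⟨quadGauss p, h⟩ = -⟨quadGauss p, h⟩ := by
  have hau : IsUnit (a : ZMod p) := by
    by_contra hu
    rw [isUnit_iff_ne_zero, not_not] at hu
    simp [hu] at ha
  obtain ⟨u, hu⟩ := hau
  have hmem : ∀ x : ZMod p, ZMod.stdAddChar x ∈ cyc n := fun x =>
    cyc_mono hpn (mem_cyc_of_pow_eq_one (stdAddChar_pow_eq_one p x))
  have e : (⟨quadGauss p, h⟩ : cyc n) =
      ∑ x : ZMod p, ((quadraticChar (ZMod p) x : ℤ) : cyc n) * ⟨ZMod.stdAddChar x, hmem x⟩ := by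
    apply Subtype.ext
    simp [quadGauss, gaussSum]
  have hs : ∀ x : ZMod p, σ ⟨ZMod.stdAddChar x, hmem x⟩ = ⟨ZMod.stdAddChar (↑u * x : ZMod p), hmem _⟩ := by
    intro x
    rw [hσ]
    · apply Subtype.ext
      simp only [SubmonoidClass.mk_pow]
      rw [← AddChar.map_nsmul_eq_pow, hu, nsmul_eq_mul]
    · obtain ⟨c, rfl⟩ := hpn
      apply Subtype.ext
      simp [pow_mul, stdAddChar_pow_eq_one p x]
  have hq : ∀ x : ZMod p, quadraticChar (ZMod p) x = -quadraticChar (ZMod p) (u * x) := by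
    intro x
    rw [map_mul, hu, ha]; ring
  rw [e, map_sum, ← Finset.sum_neg_distrib]
  refine Fintype.sum_bijective _ u.mulLeft_bijective _ _ fun x => ?_
  rw [map_mul, hs, map_intCast, hq x]
  simp

/-- Choose $a\equiv1$ mod $n$ and a nonresidue mod $p$. The corresponding automorphism of
$\mathbb{Q}(\zeta_{np})$ fixes $\mathbb{Q}(\zeta_n)$ but negates the Gauss sum, which is nonzero. -/
theorem quadGauss_notMem {n p : ℕ} [NeZero n] [Fact p.Prime] (hp : p ≠ 2) (hpn : ¬ p ∣ n) :
    quadGauss p ∉ cyc n := by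
  intro hmem
  have hpp : p.Prime := Fact.out
  have hc : ringChar (ZMod p) ≠ 2 := by rwa [ZMod.ringChar_zmod_n]
  obtain ⟨r, hr⟩ := quadraticChar_exists_neg_one hc
  have hcop : n.Coprime p := ((Nat.Prime.coprime_iff_not_dvd hpp).mpr hpn).symm
  obtain ⟨a, ha1, ha2⟩ := Nat.chineseRemainder hcop 1 r.val
  have har : (a : ZMod p) = r := by
    rw [(ZMod.natCast_eq_natCast_iff _ _ _).mpr ha2, ZMod.natCast_val, ZMod.cast_id]
  have hap : a.Coprime p := by
    rw [Nat.coprime_comm, Nat.Prime.coprime_iff_not_dvd hpp, ← ZMod.natCast_eq_zero_iff, har]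
    rintro rfl
    simp at hr
  have han : a.Coprime n := by
    have := ha1.gcd_eq
    simpa using this
  have : NeZero p := ⟨hpp.ne_zero⟩
  obtain ⟨σ, hσ⟩ := exists_aut_cyc (n := n * p) (han.mul_right hap)
  have hg : quadGauss p ∈ cyc (n * p) := cyc_mono (dvd_mul_right _ _) hmem
  have h1 := aut_quadGauss σ hσ (dvd_mul_left _ _) (by rw [har, hr]) hg
  have h2 := aut_apply_of_mem_cyc σ hσ (dvd_mul_right n p) ha1 ⟨quadGauss p, hg⟩ hmem
  have h0 : quadGauss p = 0 := by
    have := congrArg Subtype.val (h2.symm.trans h1)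
    exact self_eq_neg.mp this
  have hsq := quadGauss_sq p hp
  have hodd := (hpp.eq_two_or_odd).resolve_left hp
  rw [h0, ZMod.χ₄_nat_eq_if_mod_four, if_neg (by omega)] at hsq
  have hp0 : (p : ℂ) ≠ 0 := Nat.cast_ne_zero.mpr hpp.ne_zero
  split_ifs at hsq
  · exact hp0 (by simpa using hsq.symm)
  · exact hp0 (by simpa using hsq.symm)

/-- For odd squarefree `m`, a square root of `± m ≡ 1 (mod 4)` lies in `ℚ(ζ_m)`. -/
theorem exists_sq_eq_chi_mul {m : ℕ} (hm : Odd m) (hsq : Squarefree m) :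
    ∃ x ∈ cyc m, x ^ 2 = ((ZMod.χ₄ m * m : ℤ) : ℂ) := by
  induction m using Nat.recOnPosPrimePosCoprime with
  | zero => simp at hm
  | one => exact ⟨1, one_mem _, by simp⟩
  | prime_pow p n hp hn =>
    have hn1 : n = 1 := ((Nat.squarefree_pow_iff hp.ne_one hn.ne').mp hsq).2
    subst hn1
    rw [pow_one] at *
    have : Fact p.Prime := ⟨hp⟩
    exact ⟨_, quadGauss_mem p, quadGauss_sq p (by rintro rfl; exact absurd hm (by decide))⟩
  | coprime a b ha hb hab iha ihb =>
    obtain ⟨x, hx, ex⟩ := iha (Nat.Odd.of_mul_left hm) (hsq.of_mul_left)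
    obtain ⟨y, hy, ey⟩ := ihb (Nat.Odd.of_mul_right hm) (hsq.of_mul_right)
    refine ⟨x * y, mul_mem (cyc_mono (dvd_mul_right _ _) hx) (cyc_mono (dvd_mul_left _ _) hy), ?_⟩
    rw [mul_pow, ex, ey]
    push_cast [map_mul]
    ring

theorem I_mem_cyc : Complex.I ∈ cyc 4 := mem_cyc_of_pow_eq_one Complex.I_pow_four

theorem exists_sq_eq_of_odd {m : ℕ} (hm : Odd m) (hsq : Squarefree m) :
    ∃ x ∈ cyc (4 * m), x ^ 2 = (m : ℂ) := by
  obtain ⟨x, hx, ex⟩ := exists_sq_eq_chi_mul hm hsq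
  have hodd := Nat.odd_iff.mp hm
  rw [ZMod.χ₄_nat_eq_if_mod_four, if_neg (by omega)] at ex
  have hx' := cyc_mono (dvd_mul_left m 4) hx
  split_ifs at ex
  · exact ⟨x, hx', by simp [ex]⟩
  · refine ⟨Complex.I * x, mul_mem (cyc_mono (dvd_mul_right _ _) I_mem_cyc) hx', ?_⟩
    simp [mul_pow, ex]

/-- In the presence of $i$, having $\sqrt2$ amounts to having $\zeta_8$; this serves both to place
$\sqrt2$ in $\mathbb{Q}(\zeta_8)$ and to exclude it from $\mathbb{Q}(\zeta_{4m})$ for odd $m$. -/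
theorem isPrimitiveRoot_eight_of_sq {x : ℂ} (hx : x ^ 2 = 2) :
    IsPrimitiveRoot ((1 + Complex.I) / x) 8 := by
  have hx0 : x ≠ 0 := by rintro rfl; norm_num at hx
  have h2 : ((1 + Complex.I) / x) ^ 2 = Complex.I := by
    rw [div_pow, hx]
    ring_nf
    simp
  have h4 : ((1 + Complex.I) / x) ^ 2 ^ 2 = -1 := by
    rw [pow_succ 2 1, pow_one, pow_mul, h2, Complex.I_sq]
  rw [IsPrimitiveRoot.iff_orderOf]
  refine orderOf_eq_prime_pow (p := 2) (n := 2) (by rw [h4]; norm_num) ?_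
  rw [pow_succ 2 2, pow_mul, h4]
  norm_num

theorem exists_sq_eq_two : ∃ x ∈ cyc 8, x ^ 2 = (2 : ℂ) := by
  obtain ⟨x, hx⟩ := IsAlgClosed.exists_pow_nat_eq (2 : ℂ) two_pos
  have h := isPrimitiveRoot_eight_of_sq hx
  have hx0 : x ≠ 0 := by rintro rfl; norm_num at hx
  have h1 : (1 + Complex.I) ≠ 0 := fun h => by simpa using congrArg Complex.re h
  refine ⟨x, ?_, hx⟩
  have : x = (1 + Complex.I) / ((1 + Complex.I) / x) := by field_simp
  rw [this]
  exact div_mem (add_mem (one_mem _) (cyc_mono (by norm_num) I_mem_cyc))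
    (mem_cyc_of_pow_eq_one h.pow_eq_one)

theorem four_dvd_of_I_mem_cyc {n : ℕ} [NeZero n] (h : Complex.I ∈ cyc n) : 4 ∣ n := by
  rcases Nat.even_or_odd n with hn | hn
  · exact dvd_of_isPrimitiveRoot_mem_cyc hn Complex.isPrimitiveRoot_I h
  · have h4 := dvd_of_isPrimitiveRoot_mem_cyc (n := 2 * n) ⟨n, by ring⟩ Complex.isPrimitiveRoot_I
      (cyc_mono (dvd_mul_left _ _) h)
    have := Nat.odd_iff.mp hn
    omega

theorem sqrt_two_notMem_cyc {m : ℕ} (hm : Odd m) {x : ℂ} (hx : x ^ 2 = 2) : x ∉ cyc (4 * m) := by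
  intro hmem
  have : NeZero m := ⟨by rintro rfl; simp at hm⟩
  have h := dvd_of_isPrimitiveRoot_mem_cyc (n := 4 * m) ⟨2 * m, by ring⟩
    (isPrimitiveRoot_eight_of_sq hx)
    (div_mem (add_mem (one_mem _) (cyc_mono (dvd_mul_right _ _) I_mem_cyc)) hmem)
  have := Nat.odd_iff.mp hm
  omega

theorem dvd_of_squarefree_of_primes {m k : ℕ} (hm : Squarefree m)
    (h : ∀ p : ℕ, p.Prime → p ∣ m → p ∣ k) : m ∣ k := by
  rw [← Nat.prod_primeFactors_of_squarefree hm]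
  exact Finset.prod_primes_dvd _ (fun p hp => (Nat.prime_of_mem_primeFactors hp).prime)
    fun p hp => h p (Nat.prime_of_mem_primeFactors hp) (Nat.dvd_of_mem_primeFactors hp)

theorem squarefree_two_mul_odd {η : ℕ} (hη : Squarefree η) (h2 : ¬ Odd η) :
    ∃ m, η = 2 * m ∧ Odd m ∧ Squarefree m := by
  obtain ⟨m, rfl⟩ := (Nat.not_odd_iff_even.mp h2).two_dvd
  refine ⟨m, rfl, ?_, hη.of_mul_right⟩
  by_contra hm
  obtain ⟨l, rfl⟩ := (Nat.not_odd_iff_even.mp hm).two_dvd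
  have := hη 2 ⟨l, by ring⟩
  simp at this

theorem exists_sq_eq_of_squarefree {η : ℕ} (hη : Squarefree η) :
    ∃ x ∈ cyc (8 * η), x ^ 2 = (η : ℂ) := by
  by_cases h2 : Odd η
  · obtain ⟨x, hx, ex⟩ := exists_sq_eq_of_odd h2 hη
    exact ⟨x, cyc_mono (mul_dvd_mul_right (by norm_num) _) hx, ex⟩
  · obtain ⟨m, rfl, hm, hsq⟩ := squarefree_two_mul_odd hη h2
    obtain ⟨x, hx, ex⟩ := exists_sq_eq_of_odd hm hsq
    obtain ⟨y, hy, ey⟩ := exists_sq_eq_two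
    exact ⟨y * x, mul_mem (cyc_mono (dvd_mul_right _ _) hy)
      (cyc_mono (mul_dvd_mul (by norm_num) (dvd_mul_left _ _)) hx), by rw [mul_pow, ex, ey]; simp⟩

/-- With $\eta=pq$, dividing $\sqrt\eta$ by $\sqrt q\in\mathbb{Q}(\zeta_{8q})$ isolates $\sqrt p$ in
$\mathbb{Q}(\zeta_{8qk})$. If $p\nmid k$ this level is prime to $p$, yet the field contains the
Gauss sum $\pm\sqrt p$ or $\pm i\sqrt p$. -/
theorem prime_dvd_of_sq_mem_cyc {η k p : ℕ} [NeZero k] (hη : Squarefree η) {x : ℂ}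
    (hx : x ∈ cyc k) (hxη : x ^ 2 = (η : ℂ)) (hp : p.Prime) (hp2 : p ≠ 2) (hpη : p ∣ η) :
    p ∣ k := by
  by_contra hpk
  have : Fact p.Prime := ⟨hp⟩
  obtain ⟨q, rfl⟩ := hpη
  have hq : Squarefree q := hη.of_mul_right
  have : NeZero q := ⟨hq.ne_zero⟩
  have hpq : ¬ p ∣ q := fun ⟨c, hc⟩ =>
    hp.one_lt.ne' (Nat.isUnit_iff.mp (hη p ⟨c, by rw [hc]; ring⟩))
  have hpn : ¬ p ∣ 8 * q * k := by
    rw [hp.dvd_mul, hp.dvd_mul, show 8 = 2 ^ 3 by rfl]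
    rintro ((h | h) | h)
    · exact hp2 ((Nat.prime_dvd_prime_iff_eq hp Nat.prime_two).mp (hp.dvd_of_dvd_pow h))
    · exact hpq h
    · exact hpk h
  obtain ⟨y, hy, ey⟩ := exists_sq_eq_of_squarefree hq
  have hy' : y ∈ cyc (8 * q * k) := cyc_mono (dvd_mul_right _ _) hy
  have hx' : x ∈ cyc (8 * q * k) := cyc_mono (dvd_mul_left _ _) hx
  have hI : Complex.I ∈ cyc (8 * q * k) := cyc_mono ⟨2 * q * k, by ring⟩ I_mem_cyc
  have hz : x / y ∈ cyc (8 * q * k) := div_mem hx' hy'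
  have ez : (x / y) ^ 2 = p := by
    rw [div_pow, hxη, ey, Nat.cast_mul, mul_div_cancel_right₀]
    exact Nat.cast_ne_zero.mpr hq.ne_zero
  refine quadGauss_notMem hp2 hpn ?_
  have hsq := quadGauss_sq p hp2
  have hodd := (hp.eq_two_or_odd).resolve_left hp2
  rw [ZMod.χ₄_nat_eq_if_mod_four, if_neg (by omega)] at hsq
  split_ifs at hsq
  · rcases sq_eq_sq_iff_eq_or_eq_neg.mp (show quadGauss p ^ 2 = (x / y) ^ 2 by
      rw [hsq, ez]; simp) with h | h
    · rwa [h]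
    · rw [h]; exact neg_mem hz
  · rcases sq_eq_sq_iff_eq_or_eq_neg.mp (show quadGauss p ^ 2 = (Complex.I * (x / y)) ^ 2 by
      rw [hsq, mul_pow, ez]; simp) with h | h
    · rw [h]; exact mul_mem hI hz
    · rw [h]; exact neg_mem (mul_mem hI hz)

/-- The 2-adic valuation of the discriminant of `ℚ(√η)`, for `η` squarefree. -/
def twoExp (η : ℕ) : ℕ := if η % 4 = 1 then 0 else if η % 4 = 3 then 2 else 3

/-- `√η ∈ ℚ(ζ_k)` exactly when the discriminant of `ℚ(√η)` divides `k`. -/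
theorem exists_sq_mem_cyc_iff {η k : ℕ} [NeZero k] (hη : Squarefree η) :
    (∃ x ∈ cyc k, x ^ 2 = (η : ℂ)) ↔
      (∀ p : ℕ, p.Prime → p ≠ 2 → p ∣ η → p ∣ k) ∧ 2 ^ twoExp η ∣ k := by
  constructor
  · rintro ⟨x, hx, ex⟩
    have hodd := fun (p : ℕ) hp hp2 hpη => prime_dvd_of_sq_mem_cyc (p := p) hη hx ex hp hp2 hpη
    refine ⟨hodd, ?_⟩
    unfold twoExp
    split_ifs with h1 h3
    · simp
    · have hηo : Odd η := Nat.odd_iff.mpr (by omega)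
      have hηk : η ∣ k := dvd_of_squarefree_of_primes hη fun p hp hpη =>
        hodd p hp (by rintro rfl; omega) hpη
      -- For $\eta\equiv3$ mod 4 the field also contains $\sqrt{-\eta}$, hence
      -- $i=\pm\sqrt{-\eta}/\sqrt\eta$, which forces $4\mid k$.
      obtain ⟨z, hz, ez⟩ := exists_sq_eq_chi_mul hηo hη
      rw [ZMod.χ₄_nat_eq_if_mod_four, if_neg (by omega), if_neg h1] at ez
      have hη0 : (η : ℂ) ≠ 0 := Nat.cast_ne_zero.mpr hη.ne_zero
      have hzx : z / x ∈ cyc k := div_mem (cyc_mono hηk hz) hx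
      have e : (z / x) ^ 2 = Complex.I ^ 2 := by
        rw [div_pow, ez, ex, Complex.I_sq]
        push_cast
        field_simp
      apply four_dvd_of_I_mem_cyc
      rcases sq_eq_sq_iff_eq_or_eq_neg.mp e with h | h
      · rwa [← h]
      · rw [← neg_neg Complex.I, ← h]; exact neg_mem hzx
    · have h2 : ¬ Odd η := by rw [Nat.odd_iff]; omega
      obtain ⟨m, rfl, hm, hsq⟩ := squarefree_two_mul_odd hη h2
      -- If $8\nmid k$, then $k\mid4k'$ with $k'$ odd and $m\mid k'$, so $\sqrt{2m}/\sqrt m=\sqrt2$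
      -- would lie in $\mathbb{Q}(\zeta_{4k'})$.
      by_contra h8
      obtain ⟨j, k', hk', rfl⟩ := Nat.exists_eq_two_pow_mul_odd (NeZero.ne k)
      have hj : j ≤ 2 := by
        by_contra hj
        exact h8 ((pow_dvd_pow 2 (by omega)).mul_right _)
      have hk4 : 2 ^ j * k' ∣ 4 * k' := mul_dvd_mul_right (pow_dvd_pow 2 hj) _
      have hmk : m ∣ k' := dvd_of_squarefree_of_primes hsq fun p hp hpm => by
        have hp2 : p ≠ 2 := by
          rintro rfl
          exact absurd hm (Nat.not_odd_iff_even.mpr (even_iff_two_dvd.mpr hpm))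
        rcases hp.dvd_mul.mp (hodd p hp hp2 (hpm.mul_left _)) with h | h
        · exact absurd ((Nat.prime_dvd_prime_iff_eq hp Nat.prime_two).mp
            (hp.dvd_of_dvd_pow h)) hp2
        · exact h
      obtain ⟨y, hy, ey⟩ := exists_sq_eq_of_odd hm hsq
      have hm0 : (m : ℂ) ≠ 0 := Nat.cast_ne_zero.mpr hsq.ne_zero
      refine sqrt_two_notMem_cyc hk' (x := x / y) ?_
        (div_mem (cyc_mono hk4 hx) (cyc_mono (mul_dvd_mul_left _ hmk) hy))
      rw [div_pow, ex, ey]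
      push_cast
      field_simp
  · rintro ⟨hodd, h2⟩
    unfold twoExp at h2
    have hdvd : ∀ m, Odd m → Squarefree m → m ∣ η → m ∣ k := fun m hm hsq hmη =>
      dvd_of_squarefree_of_primes hsq fun p hp hpm => hodd p hp (by
        rintro rfl
        exact absurd hm (Nat.not_odd_iff_even.mpr (even_iff_two_dvd.mpr hpm))) (hpm.trans hmη)
    have h4 : ∀ m, Odd m → m ∣ k → 4 ∣ k → 4 * m ∣ k := fun m hm h h' =>
      Nat.Coprime.mul_dvd_of_dvd_of_dvd
        (Nat.Coprime.pow_left 2 (Nat.coprime_two_left.mpr hm)) h' h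
    split_ifs at h2 with h1 h3
    · have hηo : Odd η := Nat.odd_iff.mpr (by omega)
      obtain ⟨z, hz, ez⟩ := exists_sq_eq_chi_mul hηo hη
      rw [ZMod.χ₄_nat_eq_if_mod_four, if_neg (by omega), if_pos h1] at ez
      exact ⟨z, cyc_mono (hdvd η hηo hη dvd_rfl) hz, by simpa using ez⟩
    · have hηo : Odd η := Nat.odd_iff.mpr (by omega)
      obtain ⟨z, hz, ez⟩ := exists_sq_eq_of_odd hηo hη
      exact ⟨z, cyc_mono (h4 η hηo (hdvd η hηo hη dvd_rfl) h2) hz, ez⟩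
    · obtain ⟨m, rfl, hm, hsq⟩ := squarefree_two_mul_odd hη (by rw [Nat.odd_iff]; omega)
      obtain ⟨y, hy, ey⟩ := exists_sq_eq_two
      obtain ⟨z, hz, ez⟩ := exists_sq_eq_of_odd hm hsq
      refine ⟨y * z, mul_mem (cyc_mono h2 hy) (cyc_mono (h4 m hm (hdvd m hm hsq
        (dvd_mul_left _ _)) ((show 4 ∣ 2 ^ 3 by norm_num).trans h2)) hz), ?_⟩
      rw [mul_pow, ey, ez]; simp

end KummerDensity
end

/-! ### The discriminant of a real quadratic field. -/

noncomputable section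
namespace KummerDensity

open IntermediateField NumberField

theorem trace_quadraticAlgebra (a b : ℤ) (x : QuadraticAlgebra ℤ a b) :
    Algebra.trace ℤ _ x = 2 * x.re + b * x.im := by
  rw [Algebra.trace_eq_matrix_trace (QuadraticAlgebra.basis a b), Matrix.trace_fin_two]
  simp [Algebra.leftMulMatrix_eq_repr_mul, QuadraticAlgebra.basis]
  ring

theorem discr_quadraticAlgebra (a b : ℤ) :
    Algebra.discr ℤ (QuadraticAlgebra.basis a b) = b ^ 2 + 4 * a := by
  rw [Algebra.discr_def, Matrix.det_fin_two]
  simp [Algebra.traceMatrix_apply, Algebra.traceForm_apply, trace_quadraticAlgebra,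
    QuadraticAlgebra.basis]
  ring

/-- The ring of integers is $\mathbb{Z}[X]/(X^2-bX-a)$. The hypotheses are element-wise so that they
can be checked after embedding in $\mathbb{C}$. -/
theorem discr_eq_of_quadratic_basis {K : Type*} [Field K] [NumberField K] {a b : ℤ} (w : 𝓞 K)
    (hw : w * w = a • 1 + b • w) (hinj : ∀ x y : ℤ, (x : 𝓞 K) + y * w = 0 → x = 0 ∧ y = 0)
    (hsurj : ∀ z : 𝓞 K, ∃ x y : ℤ, z = x + y * w) : NumberField.discr K = b ^ 2 + 4 * a := by
  let f : QuadraticAlgebra ℤ a b →ₐ[ℤ] 𝓞 K := QuadraticAlgebra.lift ⟨w, hw⟩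
  have hf : ∀ z, f z = (z.re : 𝓞 K) + z.im * w := fun z => by
    simp [f, QuadraticAlgebra.lift]
  have hbij : Function.Bijective f := by
    constructor
    · rw [injective_iff_map_eq_zero]
      intro z hz
      rw [hf] at hz
      obtain ⟨h1, h2⟩ := hinj _ _ hz
      exact QuadraticAlgebra.ext h1 h2
    · intro z
      obtain ⟨x, y, rfl⟩ := hsurj z
      exact ⟨⟨x, y⟩, hf _⟩
  let e := AlgEquiv.ofBijective f hbij
  rw [← NumberField.discr_eq_discr K ((QuadraticAlgebra.basis a b).map e.toLinearEquiv),
    ← discr_quadraticAlgebra, Algebra.discr_eq_discr_of_algEquiv _ e]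
  rfl

/-- The square of the denominator divides $\eta$ times the square of the numerator, hence divides
the squarefree $\eta$. -/
theorem exists_int_of_sq_mul_eq {η : ℕ} (hη : Squarefree η) {q : ℚ} {N : ℤ}
    (h : q ^ 2 * η = N) : ∃ B : ℤ, q = B := by
  have hd : (q.den : ℚ) ≠ 0 := Nat.cast_ne_zero.mpr q.den_ne_zero
  have h1 : q.num ^ 2 * η = N * q.den ^ 2 := by
    have : (q.num : ℚ) = q * q.den := (Rat.mul_den_eq_num q).symm
    exact_mod_cast (by rw [this, ← h]; ring : (q.num : ℚ) ^ 2 * η = N * q.den ^ 2)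
  have h2 : q.den ^ 2 ∣ q.num.natAbs ^ 2 * η := by
    refine ⟨N.natAbs, ?_⟩
    have := congrArg Int.natAbs h1
    simpa [Int.natAbs_mul, Int.natAbs_pow, mul_comm] using this
  have h3 : q.den ^ 2 ∣ η :=
    (Nat.Coprime.pow 2 2 q.reduced.symm).dvd_of_dvd_mul_left h2
  have h4 : q.den = 1 := Nat.isUnit_iff.mp (hη q.den (by rwa [← sq]))
  exact ⟨q.num, (Rat.coe_int_num_of_den_eq_one h4).symm⟩

theorem sq_ne_of_squarefree {η : ℕ} (hη : Squarefree η) (h1 : η ≠ 1) (r : ℚ) :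
    r ^ 2 ≠ (η : ℚ) := by
  intro h
  obtain ⟨B, rfl⟩ := exists_int_of_sq_mul_eq (q := r) (N := η ^ 2) hη (by rw [h]; push_cast; ring)
  have : B.natAbs ^ 2 = η := by
    zify
    rw [sq_abs]
    exact_mod_cast h
  refine h1 ?_
  rw [← this, Nat.isUnit_iff.mp (hη B.natAbs ⟨1, by rw [← this]; ring⟩), one_pow]

/-- The map `ℚ[X]/(X² - η) → ℂ` attached to a square root of `η`. -/
def sqrtHom {η : ℕ} {s : ℂ} (hs : s ^ 2 = (η : ℂ)) : QuadraticAlgebra ℚ (η : ℚ) 0 →ₐ[ℚ] ℂ :=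
  QuadraticAlgebra.lift ⟨s, by rw [← sq, hs]; simp [Algebra.smul_def]⟩

theorem sqrtHom_apply {η : ℕ} {s : ℂ} (hs : s ^ 2 = (η : ℂ)) (z) :
    sqrtHom hs z = (z.re : ℂ) + z.im * s := by
  simp [sqrtHom, QuadraticAlgebra.lift, Algebra.smul_def]

/-- Here $A$ and $C$ are the trace and the norm of $z$, computed in `QuadraticAlgebra`, where
conjugation is `star`. $B$ is twice the coefficient of $s$; it is an integer because $\eta
B^2=A^2-4C$. -/
theorem exists_coords_of_isIntegral {η : ℕ} (hη : Squarefree η) (h1 : η ≠ 1) {s : ℂ}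
    (hs : s ^ 2 = (η : ℂ)) {z : ℂ} (hz : z ∈ quadField η) (hint : IsIntegral ℤ z) :
    ∃ A B C : ℤ, 2 * z = A + B * s ∧ A ^ 2 = η * B ^ 2 + 4 * C := by
  have : Fact (∀ r : ℚ, r ^ 2 ≠ (η : ℚ) + 0 * r) := ⟨fun r => by
    simpa using sq_ne_of_squarefree hη h1 r⟩
  have hle : quadField η ≤ (sqrtHom hs).fieldRange := by
    refine adjoin_le_iff.mpr fun x hx => ?_
    have hx : x ^ 2 = ((η : ℚ) : ℂ) := hx
    rcases sq_eq_sq_iff_eq_or_eq_neg.mp (hx.trans (by rw [hs]; simp)) with h | h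
    · exact ⟨⟨0, 1⟩, by simp [sqrtHom_apply, h]⟩
    · exact ⟨⟨0, -1⟩, by simp [sqrtHom_apply, h]⟩
  obtain ⟨q, rfl⟩ := hle hz
  have hq : IsIntegral ℤ q := by
    have : Function.Injective ((sqrtHom hs).restrictScalars ℤ) := (sqrtHom hs).injective
    exact (isIntegral_algHom_iff ((sqrtHom hs).restrictScalars ℤ) this).mp hint
  have hq' : IsIntegral ℤ (star q) := hq.map (starRingEnd (QuadraticAlgebra ℚ (η : ℚ) 0)).toIntAlgHom
  have ht : IsIntegral ℤ (QuadraticAlgebra.trace q) := by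
    have h := hq.add hq'
    rw [← QuadraticAlgebra.algebraMap_trace_eq_add_star] at h
    exact (isIntegral_algebraMap_iff (algebraMap ℚ (QuadraticAlgebra ℚ (η : ℚ) 0)).injective).mp h
  have hn : IsIntegral ℤ (QuadraticAlgebra.norm q) := by
    have h := hq.mul hq'
    rw [← QuadraticAlgebra.algebraMap_norm_eq_mul_star] at h
    exact (isIntegral_algebraMap_iff (algebraMap ℚ (QuadraticAlgebra ℚ (η : ℚ) 0)).injective).mp h
  obtain ⟨A, hA⟩ := IsIntegrallyClosed.isIntegral_iff.mp ht
  obtain ⟨C, hC⟩ := IsIntegrallyClosed.isIntegral_iff.mp hn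
  simp only [QuadraticAlgebra.trace_def, QuadraticAlgebra.norm_def, eq_intCast] at hA hC
  obtain ⟨B, hB⟩ := exists_int_of_sq_mul_eq (q := 2 * q.im) (N := A ^ 2 - 4 * C) hη (by
    push_cast; rw [hA, hC]; ring)
  refine ⟨A, B, C, ?_, ?_⟩
  · have e1 : (A : ℂ) = 2 * (q.re : ℂ) := by
      have : (A : ℚ) = 2 * q.re := by rw [hA]; ring
      exact_mod_cast congrArg (fun x : ℚ => (x : ℂ)) this
    have e2 : (B : ℂ) = 2 * (q.im : ℂ) := by
      exact_mod_cast congrArg (fun x : ℚ => (x : ℂ)) hB.symm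
    change 2 * sqrtHom hs q = _
    rw [sqrtHom_apply, e1, e2]; ring
  · have : (A : ℚ) ^ 2 = η * B ^ 2 + 4 * C := by rw [← hB, hA, hC]; ring
    exact_mod_cast this

theorem int_add_int_mul_eq_zero {η : ℕ} (hη : Squarefree η) (h1 : η ≠ 1) {s : ℂ}
    (hs : s ^ 2 = (η : ℂ)) {x y : ℤ} (h : (x : ℂ) + y * s = 0) : x = 0 ∧ y = 0 := by
  have hy : y = 0 := by
    by_contra hy
    have hy' : (y : ℂ) ≠ 0 := Int.cast_ne_zero.mpr hy
    have e : s = ((-x / y : ℚ) : ℂ) := by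
      push_cast
      field_simp
      linear_combination h
    refine sq_ne_of_squarefree hη h1 (-x / y) ?_
    rw [e] at hs
    exact_mod_cast hs
  subst hy
  simpa using h

/-- The embedding of the ring of integers of `ℚ(√η)` in `ℂ`. -/
def integerVal (q : ℚ) : 𝓞 (quadField q) →+* ℂ :=
  (algebraMap (quadField q) ℂ).comp (algebraMap (𝓞 (quadField q)) (quadField q))

theorem integerVal_injective (q : ℚ) : Function.Injective (integerVal q) :=
  (algebraMap (quadField q) ℂ).injective.comp RingOfIntegers.coe_injective

theorem exists_integerVal_eq {q : ℚ} {z : ℂ} (hz : z ∈ quadField q) (hint : IsIntegral ℤ z) :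
    ∃ w : 𝓞 (quadField q), integerVal q w = z :=
  ⟨⟨⟨z, hz⟩, (isIntegral_algebraMap_iff (algebraMap (quadField q) ℂ).injective).mp hint⟩, rfl⟩

theorem isIntegral_integerVal {q : ℚ} (w : 𝓞 (quadField q)) : IsIntegral ℤ (integerVal q w) :=
  (RingOfIntegers.isIntegral w).map (integerVal q).toIntAlgHom

theorem integerVal_mem {q : ℚ} (w : 𝓞 (quadField q)) : integerVal q w ∈ quadField q :=
  SetLike.coe_mem (w : quadField q)

/-- An integral basis is $1,(1+\sqrt\eta)/2$ if $\eta\equiv1$ mod 4 and $1,\sqrt\eta$ otherwise;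
spanning comes from reading $A^2=\eta B^2+4C$ modulo 2 or 4. -/
theorem fieldDisc_eq {η : ℕ} (hη : Squarefree η) (h1 : η ≠ 1) :
    fieldDisc (η : ℚ) = if η % 4 = 1 then (η : ℤ) else 4 * η := by
  obtain ⟨s, hs⟩ := IsAlgClosed.exists_pow_nat_eq (η : ℂ) two_pos
  have hsmem : s ∈ quadField (η : ℚ) := subset_adjoin _ _ (by simpa using hs)
  have hsint : IsIntegral ℤ s := IsIntegral.of_pow (n := 2) two_pos (by
    rw [hs]
    simpa using isIntegral_algebraMap (R := ℤ) (A := ℂ) (x := (η : ℤ)))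
  split_ifs with h4
  · obtain ⟨c, hc⟩ : ∃ c : ℕ, η = 4 * c + 1 := ⟨η / 4, by omega⟩
    have hcC : (η : ℂ) = 4 * c + 1 := by exact_mod_cast congrArg (fun n : ℕ => (n : ℂ)) hc
    have hsq : ((1 + s) / 2) * ((1 + s) / 2) = c + (1 + s) / 2 := by
      linear_combination (hs + hcC) / 4
    have hwint : IsIntegral ℤ ((1 + s) / 2) := by
      refine ⟨Polynomial.X ^ 2 - Polynomial.X - Polynomial.C (c : ℤ), by monicity!, ?_⟩
      simp only [Polynomial.eval₂_sub, Polynomial.eval₂_pow, Polynomial.eval₂_X,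
        Polynomial.eval₂_C]
      rw [sq, hsq]
      simp
    have hwmem : (1 + s) / 2 ∈ quadField (η : ℚ) :=
      div_mem (add_mem (one_mem _) hsmem) (ofNat_mem _ 2)
    obtain ⟨w, hw⟩ := exists_integerVal_eq hwmem hwint
    rw [fieldDisc, discr_eq_of_quadratic_basis (a := c) (b := 1) w]
    · rw [hc]; push_cast; ring
    · apply integerVal_injective
      rw [map_mul, hw, hsq]
      simp [hw]
    · intro x y hxy
      have := congrArg (integerVal _) hxy
      simp only [map_add, map_mul, map_intCast, hw, map_zero] at this
      obtain ⟨e1, e2⟩ := int_add_int_mul_eq_zero hη h1 hs (x := 2 * x + y) (y := y) (by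
        push_cast
        linear_combination 2 * this)
      omega
    · intro z
      obtain ⟨A, B, C, hz, hABC⟩ := exists_coords_of_isIntegral hη h1 hs (integerVal_mem z)
        (isIntegral_integerVal z)
      have hpar : Even (A - B) := by
        have : Even (A ^ 2 - B ^ 2) := ⟨2 * c * B ^ 2 + 2 * C, by rw [hABC, hc]; push_cast; ring⟩
        rw [Int.even_sub, Int.even_pow' two_ne_zero, Int.even_pow' two_ne_zero] at this
        rwa [Int.even_sub]
      obtain ⟨D, hD⟩ := hpar
      refine ⟨D, B, integerVal_injective _ ?_⟩
      have hDC : (A : ℂ) - B = D + D := by exact_mod_cast congrArg (fun n : ℤ => (n : ℂ)) hD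
      simp only [map_add, map_mul, map_intCast, hw]
      linear_combination hz / 2 + hDC / 2
  · obtain ⟨w, hw⟩ := exists_integerVal_eq hsmem hsint
    rw [fieldDisc, discr_eq_of_quadratic_basis (a := η) (b := 0) w]
    · ring
    · apply integerVal_injective
      rw [map_mul, hw, ← sq, hs]
      simp
    · intro x y hxy
      have := congrArg (integerVal _) hxy
      simp only [map_add, map_mul, map_intCast, hw, map_zero] at this
      exact int_add_int_mul_eq_zero hη h1 hs this
    · intro z
      obtain ⟨A, B, C, hz, hABC⟩ := exists_coords_of_isIntegral hη h1 hs (integerVal_mem z)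
        (isIntegral_integerVal z)
      have h40 : η % 4 ≠ 0 := fun h0 => by
        have := hη 2 (Nat.dvd_of_mod_eq_zero h0)
        simp at this
      -- An odd $B$ would give $A^2\equiv\eta$ mod 4, impossible for $\eta\equiv2,3$.
      have hB : Even B := by
        by_contra hB
        obtain ⟨b, rfl⟩ := Int.not_even_iff_odd.mp hB
        rw [show (η : ℤ) * (2 * b + 1) ^ 2 = 4 * (η * (b ^ 2 + b)) + η by ring] at hABC
        rcases Int.even_or_odd' A with ⟨a, rfl | rfl⟩
        · rw [mul_pow] at hABC
          omega
        · rw [show (2 * a + 1) ^ 2 = 4 * (a ^ 2 + a) + 1 by ring] at hABC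
          omega
      have hA : Even A := by
        obtain ⟨b, rfl⟩ := hB
        have : Even (A ^ 2) := ⟨2 * η * b ^ 2 + 2 * C, by rw [hABC]; ring⟩
        exact (Int.even_pow' two_ne_zero).mp this
      obtain ⟨A', hA⟩ := hA
      obtain ⟨B', hB⟩ := hB
      refine ⟨A', B', integerVal_injective _ ?_⟩
      have hAC : (A : ℂ) = A' + A' := by exact_mod_cast congrArg (fun n : ℤ => (n : ℂ)) hA
      have hBC : (B : ℂ) = B' + B' := by exact_mod_cast congrArg (fun n : ℤ => (n : ℂ)) hB
      simp only [map_add, map_mul, map_intCast, hw]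
      linear_combination hz / 2 + hAC / 2 + s * hBC / 2

theorem padicValInt_fieldDisc {η : ℕ} (hη : Squarefree η) (h1 : η ≠ 1) :
    padicValInt 2 (fieldDisc (η : ℚ)) = twoExp η := by
  have h40 : η % 4 ≠ 0 := fun h0 => by
    have := hη 2 (Nat.dvd_of_mod_eq_zero h0)
    simp at this
  rw [fieldDisc_eq hη h1, twoExp]
  split_ifs with h h3
  · rw [padicValInt.of_nat]
    exact padicValNat.eq_zero_of_not_dvd (by omega)
  · rw [show (4 * η : ℤ) = ((2 ^ 2 * η : ℕ) : ℤ) by push_cast; ring, padicValInt.of_nat,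
      padicValNat.mul (by norm_num) hη.ne_zero, padicValNat.prime_pow,
      padicValNat.eq_zero_of_not_dvd (by omega : ¬ 2 ∣ η)]
  · obtain ⟨m, rfl⟩ : 2 ∣ η := by omega
    rw [show (4 * (2 * m : ℕ) : ℤ) = ((2 ^ 3 * m : ℕ) : ℤ) by push_cast; ring, padicValInt.of_nat,
      padicValNat.mul (by norm_num) (by omega), padicValNat.prime_pow,
      padicValNat.eq_zero_of_not_dvd (by omega : ¬ 2 ∣ m)]

end KummerDensity
end

/-! ### Kummer theory for a homomorphism into the units. -/

noncomputable section
namespace KummerDensity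

section Kummer

variable {K L : Type*} [Field K] [Field L] [Algebra K L]

/-- The Kummer character `σ ↦ σ a / a`. -/
def kummerChar (a : Lˣ) (ha : ∀ σ : L ≃ₐ[K] L, ∃ c : K, σ a = algebraMap K L c * a) :
    (L ≃ₐ[K] L) →* L where
  toFun σ := σ a * (a : L)⁻¹
  map_one' := by simp
  map_mul' σ τ := by
    obtain ⟨c, hc⟩ := ha τ
    rw [AlgEquiv.mul_apply, hc, map_mul, AlgEquiv.commutes]
    field_simp

/-- Kummer theory: if a Galois extension `L / K` is generated by the image of a homomorphism
`r : G → Lˣ` whose values are moved by the Galois group only by factors in `K`, then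
`[L : K]` is the index of the preimage of `Kˣ`. -/
theorem finrank_eq_index_of_kummer [IsGalois K L] {G : Type*} [CommGroup G] (r : G →* Lˣ)
    (hr : ∀ g, ∀ σ : L ≃ₐ[K] L, ∃ c : K, σ (r g) = algebraMap K L c * r g)
    (hgen : Algebra.adjoin K (Set.range fun g => (r g : L)) = ⊤) :
    Module.finrank K L = ((Units.map (algebraMap K L : K →* L)).range.comap r).index := by
  set H := (Units.map (algebraMap K L : K →* L)).range.comap r with hH
  let v : G ⧸ H → L := fun q => r q.out
  have hmem : ∀ g, (∃ x : K, algebraMap K L x = r g) → g ∈ H := by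
    rintro g ⟨x, hx⟩
    have hx0 : x ≠ 0 := by
      rintro rfl
      rw [map_zero] at hx
      exact (r g).ne_zero hx.symm
    exact ⟨Units.mk0 x hx0, Units.ext hx⟩
  -- If two cosets have the same character, the quotient of their values under $r$ is Galois-fixed,
  -- hence in $K$, and the cosets agree.
  have hinj : Function.Injective fun q : G ⧸ H => kummerChar (K := K) (r q.out) (hr q.out) := by
    intro p q hpq
    rw [← Quotient.out_eq' p, ← Quotient.out_eq' q, QuotientGroup.eq]
    apply hmem
    refine (InfiniteGalois.mem_bot_iff_fixed (k := K) ((r (p.out⁻¹ * q.out) : Lˣ) : L)).mpr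
      fun σ => ?_
    have h := DFunLike.congr_fun hpq σ
    simp only [kummerChar, MonoidHom.coe_mk, OneHom.coe_mk] at h
    have hp := (r p.out).ne_zero
    have hq := (r q.out).ne_zero
    have hp' : σ (r p.out) ≠ 0 := fun h => hp ((map_eq_zero σ).mp h)
    rw [map_mul, map_inv, Units.val_mul, Units.val_inv_eq_inv_val, map_mul, map_inv₀]
    field_simp at h ⊢
    linear_combination -h
  -- Applying every $\sigma$ to a linear relation turns it into a relation between distinct
  -- characters, excluded by Dedekind's theorem.
  have hli : LinearIndependent K v := by
    rw [linearIndependent_iff']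
    intro s c hc q hq
    have hind := (linearIndependent_monoidHom (L ≃ₐ[K] L) L).comp _ hinj
    rw [linearIndependent_iff'] at hind
    have h := hind s (fun q => algebraMap K L (c q) * v q) (by
      ext σ
      have h := congrArg σ hc
      simp only [map_sum, map_smul, map_zero] at h
      rw [Finset.sum_apply, Pi.zero_apply, ← h]
      refine Finset.sum_congr rfl fun q _ => ?_
      have hq := (r q.out).ne_zero
      simp only [Pi.smul_apply, Function.comp_apply, kummerChar, MonoidHom.coe_mk, OneHom.coe_mk,
        smul_eq_mul, Algebra.smul_def, v]
      field_simp) q hq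
    rcases mul_eq_zero.mp h with h | h
    · exact (map_eq_zero _).mp h
    · exact absurd h (r q.out).ne_zero
  -- The image of $r$ is closed under multiplication, so its linear span is already the algebra it
  -- generates; modulo $K^*$ one representative per coset suffices.
  have hspan : ⊤ ≤ Submodule.span K (Set.range v) := by
    have h : (⊤ : Submodule K L) = Submodule.span K (Set.range fun g => (r g : L)) := by
      rw [← Algebra.top_toSubmodule, ← hgen, Algebra.adjoin_eq_span]
      congr 1
      have : (Set.range fun g => (r g : L)) = MonoidHom.mrange ((Units.coeHom L).comp r) := rfl
      rw [this, Submonoid.closure_eq]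
    rw [h, Submodule.span_le]
    rintro _ ⟨g, rfl⟩
    have hg : (QuotientGroup.mk g : G ⧸ H).out⁻¹ * g ∈ H := by
      rw [← QuotientGroup.eq, QuotientGroup.out_eq']
    obtain ⟨x, hx⟩ := hg
    have : (r g : L) = (x : K) • v (QuotientGroup.mk g) := by
      have hx := congrArg Units.val hx
      rw [map_mul, map_inv, Units.val_mul, Units.val_inv_eq_inv_val] at hx
      have h0 := (r (QuotientGroup.mk g : G ⧸ H).out).ne_zero
      rw [Algebra.smul_def]
      change (r g : L) = algebraMap K L x * r (QuotientGroup.mk g : G ⧸ H).out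
      have hx : algebraMap K L x = _ := hx
      rw [hx]
      field_simp
    simp only [this]
    exact Submodule.smul_mem _ _ (Submodule.subset_span ⟨_, rfl⟩)
  rw [Module.finrank_eq_nat_card_basis (Module.Basis.mk hli hspan)]
  rfl

end Kummer

end KummerDensity
end

/-! ### The degree of the Kummer field through elements that become $k$-th powers. -/

noncomputable section
namespace KummerDensity

open IntermediateField

/-- The subgroup of the nonzero rationals which become `k`-th powers in `ℚ(ζ_k)`. -/
def cycPowers (k : ℕ) : Subgroup ℚˣ where
  carrier := {u | ∃ z ∈ cyc k, z ^ k = ((u : ℚ) : ℂ)}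
  one_mem' := ⟨1, one_mem _, by simp⟩
  mul_mem' := by
    rintro u v ⟨y, hy, ey⟩ ⟨z, hz, ez⟩
    exact ⟨y * z, mul_mem hy hz, by rw [mul_pow, ey, ez]; simp⟩
  inv_mem' := by
    rintro u ⟨y, hy, ey⟩
    exact ⟨y⁻¹, inv_mem hy, by rw [inv_pow, ey]; simp⟩

theorem powers_le_cycPowers (k : ℕ) : powers k ≤ cycPowers k := by
  rintro _ ⟨x, rfl⟩
  exact ⟨((x : ℚ) : ℂ), (cyc k).algebraMap_mem (x : ℚ), by simp⟩

/-- The positive real `k`-th root of a rational number, in `ℂ`. -/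
def posRoot (k : ℕ) (q : ℚ) : ℂ := (((q : ℝ) ^ ((k : ℝ)⁻¹) : ℝ) : ℂ)

theorem posRoot_pow {k : ℕ} (hk : k ≠ 0) {q : ℚ} (hq : 0 < q) : posRoot k q ^ k = (q : ℂ) := by
  rw [posRoot, ← Complex.ofReal_pow, Real.rpow_inv_natCast_pow (by exact_mod_cast hq.le) hk]
  simp

theorem posRoot_mul {k : ℕ} {p q : ℚ} (hp : 0 < p) (hq : 0 < q) :
    posRoot k (p * q) = posRoot k p * posRoot k q := by
  rw [posRoot, Rat.cast_mul, Real.mul_rpow (by exact_mod_cast hp.le) (by exact_mod_cast hq.le)]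
  simp [posRoot]

theorem posRoot_ne_zero {k : ℕ} {q : ℚ} (hq : 0 < q) : posRoot k q ≠ 0 := by
  have : (0 : ℝ) < (q : ℝ) ^ ((k : ℝ)⁻¹) := Real.rpow_pos_of_pos (by exact_mod_cast hq) _
  exact Complex.ofReal_ne_zero.mpr this.ne'

theorem div_mem_cyc {k : ℕ} {y z : ℂ} (hy : y ≠ 0) (h : z ^ k = y ^ k) : z / y ∈ cyc k :=
  mem_cyc_of_pow_eq_one (by rw [div_pow, h, div_self (pow_ne_zero _ hy)])

section

variable {Γ : Subgroup ℚˣ}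

theorem cyc_le_kummerField (k : ℕ) : cyc k ≤ kummerField Γ k :=
  adjoin.mono _ _ _ Set.subset_union_left

theorem mem_kummerField {k : ℕ} {g : ℚˣ} (hg : g ∈ Γ) {z : ℂ} (hz : z ^ k = ((g : ℚ) : ℂ)) :
    z ∈ kummerField Γ k :=
  subset_adjoin _ _ (Or.inr ⟨g, hg, hz⟩)

/-- The field generated by all `k`-th roots of `q`. -/
def allRoots (k : ℕ) (q : ℚ) : IntermediateField ℚ ℂ :=
  adjoin ℚ ((Polynomial.X ^ k - Polynomial.C q).rootSet ℂ)

instance normal_allRoots (k : ℕ) (q : ℚ) : Normal ℚ (allRoots k q) := by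
  have : Polynomial.IsSplittingField ℚ (allRoots k q) (Polynomial.X ^ k - Polynomial.C q) :=
    adjoin_rootSet_isSplittingField (IsAlgClosed.splits _)
  exact Normal.of_isSplittingField (Polynomial.X ^ k - Polynomial.C q)

theorem mem_rootSet_X_pow_sub_C {k : ℕ} (hk : 0 < k) {q : ℚ} {z : ℂ} :
    z ∈ (Polynomial.X ^ k - Polynomial.C q).rootSet ℂ ↔ z ^ k = (q : ℂ) := by
  rw [Polynomial.mem_rootSet_of_ne (Polynomial.X_pow_sub_C_ne_zero hk _)]
  simp [sub_eq_zero]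

/-- A compositum of splitting fields, hence normal; the roots of unity come from $g=1$. -/
theorem kummerField_eq_iSup (Γ : Subgroup ℚˣ) (k : ℕ) [NeZero k] :
    kummerField Γ k = ⨆ g : Γ, allRoots k (g : ℚˣ) := by
  have hmem : ∀ (g : Γ) (z : ℂ), z ^ k = (((g : ℚˣ) : ℚ) : ℂ) →
      z ∈ ⨆ g : Γ, allRoots k (g : ℚˣ) := fun g z hz => by
    have h := le_iSup (fun g : Γ => allRoots k (g : ℚˣ)) g
    exact h (subset_adjoin _ _ ((mem_rootSet_X_pow_sub_C (NeZero.pos k)).mpr hz))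
  apply le_antisymm
  · refine adjoin_le_iff.mpr fun z hz => ?_
    rcases hz with hz | ⟨g, hg, hz⟩
    · exact hmem 1 z (by simpa using hz)
    · exact hmem ⟨g, hg⟩ z hz
  · exact iSup_le fun g => adjoin_le_iff.mpr fun z hz =>
      mem_kummerField g.2 ((mem_rootSet_X_pow_sub_C (NeZero.pos k)).mp hz)

instance isGalois_kummerField (Γ : Subgroup ℚˣ) (k : ℕ) [NeZero k] :
    IsGalois ℚ (kummerField Γ k) := by
  have hn : Normal ℚ (kummerField Γ k) := by
    rw [kummerField_eq_iSup]
    exact normal_iSup ℚ ℂ (h := fun g : Γ => normal_allRoots k (g : ℚˣ)) _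
  have := hn.toIsAlgebraic
  exact { to_normal := hn, to_isSeparable := inferInstance }

/-- The positive `k`-th root as a homomorphism into `ℚ(ζ_k, Γ^{1/k})`. -/
def rootHom (hpos : ∀ g ∈ Γ, 0 < (g : ℚ)) (k : ℕ) [NeZero k] : Γ →* (kummerField Γ k)ˣ where
  toFun g := Units.mk0 ⟨posRoot k (g : ℚˣ),
      mem_kummerField g.2 (posRoot_pow (NeZero.ne k) (hpos g g.2))⟩
    fun h => posRoot_ne_zero (hpos g g.2) (congrArg Subtype.val h)
  map_one' := by
    ext
    simp [posRoot]
  map_mul' g h := by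
    ext
    exact posRoot_mul (hpos g g.2) (hpos h h.2)

/-- The tower passes through $\mathbb{Q}(\zeta_k)$. Two $k$-th roots of $g$ differ by a root of
unity, so the positive root lies in $\mathbb{Q}(\zeta_k)$ as soon as some root does; this identifies
the subgroup in `finrank_eq_index_of_kummer` with `cycPowers k`. -/
theorem finrank_kummerField (hpos : ∀ g ∈ Γ, 0 < (g : ℚ)) (k : ℕ) [NeZero k] :
    Module.finrank ℚ (kummerField Γ k) = k.totient * (cycPowers k).relIndex Γ := by
  let := (inclusion (cyc_le_kummerField (Γ := Γ) k)).toRingHom.toAlgebra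
  have hmap : ∀ x : cyc k, ((algebraMap (cyc k) (kummerField Γ k) x : kummerField Γ k) : ℂ) = x :=
    fun _ => rfl
  have : IsScalarTower ℚ (cyc k) (kummerField Γ k) := IsScalarTower.of_algebraMap_eq fun _ => rfl
  have hgal : IsGalois (cyc k) (kummerField Γ k) := IsGalois.tower_top_of_isGalois ℚ _ _
  have hr : ∀ g : Γ, ((rootHom hpos k g : kummerField Γ k) : ℂ) = posRoot k (g : ℚˣ) :=
    fun _ => rfl
  have hpow : ∀ g : Γ, (rootHom hpos k g : kummerField Γ k) ^ k =
      algebraMap ℚ (kummerField Γ k) (g : ℚˣ) := fun g =>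
    Subtype.ext (posRoot_pow (NeZero.ne k) (hpos g g.2))
  rw [← Module.finrank_mul_finrank ℚ (cyc k), finrank_cyc,
    finrank_eq_index_of_kummer (rootHom hpos k)]
  · congr 1
    rw [Subgroup.relIndex]
    congr 1
    ext g
    rw [Subgroup.mem_comap, Subgroup.mem_subgroupOf]
    constructor
    · rintro ⟨z, hz⟩
      have hz : algebraMap (cyc k) (kummerField Γ k) z = rootHom hpos k g := congrArg Units.val hz
      refine ⟨(z : cyc k), SetLike.coe_mem _, ?_⟩
      rw [← hmap, hz]
      exact posRoot_pow (NeZero.ne k) (hpos g g.2)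
    · rintro ⟨z, hz, ez⟩
      have hg0 := posRoot_ne_zero (k := k) (hpos g g.2)
      have hgp := posRoot_pow (NeZero.ne k) (hpos g g.2)
      have hz0 : z ≠ 0 := by
        rintro rfl
        rw [zero_pow (NeZero.ne k), eq_comm, Rat.cast_eq_zero] at ez
        exact (g : ℚˣ).ne_zero ez
      have hmem : posRoot k (g : ℚˣ) ∈ cyc k := by
        have := mul_mem (div_mem_cyc hz0 (hgp.trans ez.symm)) hz
        rwa [div_mul_cancel₀ _ hz0] at this
      exact ⟨Units.mk0 ⟨_, hmem⟩ fun h => hg0 (congrArg Subtype.val h), Units.ext rfl⟩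
  · intro g σ
    have hs : (σ (rootHom hpos k g)) ^ k = (rootHom hpos k g : kummerField Γ k) ^ k := by
      have hc : σ (algebraMap ℚ (kummerField Γ k) (g : ℚˣ)) =
          algebraMap ℚ (kummerField Γ k) (g : ℚˣ) := (σ.restrictScalars ℚ).commutes _
      rw [← map_pow, hpow, hc]
    have h0 : ((rootHom hpos k g : kummerField Γ k) : ℂ) ≠ 0 := posRoot_ne_zero (hpos g g.2)
    refine ⟨⟨_, div_mem_cyc h0 (congrArg Subtype.val hs)⟩, Subtype.ext ?_⟩
    change _ = _ / _ * _
    rw [div_mul_cancel₀ _ h0]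
  · rw [eq_top_iff]
    rintro ⟨z, hz⟩ -
    have hroot : ∀ (w : ℂ) (hw : w ^ k = 1) (hw' : w ∈ kummerField Γ k),
        (⟨w, hw'⟩ : kummerField Γ k) ∈ Algebra.adjoin (cyc k)
          (Set.range fun g => (rootHom hpos k g : kummerField Γ k)) := fun w hw hw' =>
      Subalgebra.algebraMap_mem _ (⟨w, mem_cyc_of_pow_eq_one hw⟩ : cyc k)
    induction hz using IntermediateField.adjoin_induction with
    | mem w hw =>
      rcases hw with hw | ⟨g, hg, hw⟩
      · exact hroot w hw _
      · have hgp := posRoot_pow (NeZero.ne k) (hpos g hg)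
        have hg0 := posRoot_ne_zero (k := k) (hpos g hg)
        have h1 : (w / posRoot k g) ^ k = 1 := by
          rw [div_pow, hw, hgp, div_self]
          exact Rat.cast_ne_zero.mpr g.ne_zero
        have h2 := mul_mem (hroot _ h1 (cyc_le_kummerField k (mem_cyc_of_pow_eq_one h1)))
          (Algebra.subset_adjoin (R := cyc k) (Set.mem_range_self (f := fun g =>
            (rootHom hpos k g : kummerField Γ k)) (⟨g, hg⟩ : Γ)))
        convert! h2 using 1
        apply Subtype.ext
        change w = w / posRoot k g * posRoot k g
        rw [div_mul_cancel₀ _ hg0]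
    | algebraMap q =>
      exact Subalgebra.algebraMap_mem _ (algebraMap ℚ (cyc k) q)
    | add x y hx hy hx' hy' => exact add_mem hx' hy'
    | mul x y hx hy hx' hy' => exact mul_mem hx' hy'
    | inv x hx hx' =>
      exact Subalgebra.inv_mem_of_algebraic _ (x := ⟨_, hx'⟩)
        (Algebra.IsAlgebraic.isAlgebraic (R := cyc k) _)

theorem card_GammaMod (Γ : Subgroup ℚˣ) (k : ℕ) :
    Nat.card (GammaMod Γ k) = (powers k).relIndex Γ := by
  rw [GammaMod, ← Subgroup.relIndex_ker, QuotientGroup.ker_mk']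

theorem finrank_mul_card (hpos : ∀ g ∈ Γ, 0 < (g : ℚ)) (k : ℕ) [NeZero k] :
    Module.finrank ℚ (kummerField Γ k) *
      Nat.card ((cycPowers k ⊓ Γ).map (QuotientGroup.mk' (powers k))) =
      k.totient * Nat.card (GammaMod Γ k) := by
  rw [finrank_kummerField hpos, card_GammaMod, ← Subgroup.relIndex_ker, QuotientGroup.ker_mk',
    mul_assoc, mul_comm (Subgroup.relIndex _ Γ), Subgroup.relIndex_inf_mul_relIndex,
    inf_of_le_left (powers_le_cycPowers k)]

end

/-- If a real element of `ℚ(ζ_k)` has a rational `k`-th power, then its square is rational. -/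
theorem exists_rat_eq_sq {k : ℕ} [NeZero k] {c : ℝ} (hc : (c : ℂ) ∈ cyc k) {q : ℚ}
    (hq : (c : ℂ) ^ k = (q : ℂ)) : ∃ r : ℚ, (r : ℝ) = c ^ 2 := by
  have hgal : IsGalois ℚ (cyc k) := IsCyclotomicExtension.isGalois {k} ℚ (cyc k)
  have hcomm := IsCyclotomicExtension.isMulCommutative {k} ℚ (cyc k)
  let x : cyc k := ⟨c, hc⟩
  let τ : cyc k ≃ₐ[ℚ] cyc k := (Complex.conjAe.restrictScalars ℚ).restrictNormal (cyc k)
  have hτ : ∀ y : cyc k, ((τ y : cyc k) : ℂ) = (starRingEnd ℂ) y := fun y =>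
    (Complex.conjAe.restrictScalars ℚ).restrictNormal_commutes (cyc k) y
  have hx : τ x = x := Subtype.ext (by rw [hτ]; simp [x])
  -- The Galois group is abelian, so $\sigma x$ is again fixed by complex conjugation. Being real
  -- with the same $k$-th power as $x$, it equals $\pm x$.
  have hfix : ∀ σ : cyc k ≃ₐ[ℚ] cyc k, σ (x ^ 2) = x ^ 2 := by
    intro σ
    have h1 : τ (σ x) = σ x := by
      have h : τ * σ = σ * τ := hcomm.is_comm.comm _ _
      have := DFunLike.congr_fun h x
      rwa [AlgEquiv.mul_apply, AlgEquiv.mul_apply, hx] at this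
    have h2 : (starRingEnd ℂ) (σ x : cyc k) = (σ x : cyc k) := by rw [← hτ, h1]
    obtain ⟨d, hd⟩ := Complex.conj_eq_iff_real.mp h2
    have h3 : (σ x) ^ k = x ^ k := by
      have : x ^ k = algebraMap ℚ (cyc k) q := Subtype.ext hq
      rw [← map_pow, this, AlgEquiv.commutes]
    have h4 : d ^ k = c ^ k := by
      have := congrArg Subtype.val h3
      simp only [SubmonoidClass.coe_pow, hd] at this
      change (d : ℂ) ^ k = (c : ℂ) ^ k at this
      exact_mod_cast this
    have h5 : |d| = |c| := by
      refine (pow_left_inj₀ (abs_nonneg _) (abs_nonneg _) (NeZero.ne k)).mp ?_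
      rw [← abs_pow, ← abs_pow, h4]
    have h6 : d ^ 2 = c ^ 2 := by rw [← sq_abs, h5, sq_abs]
    rw [map_pow]
    apply Subtype.ext
    simp only [SubmonoidClass.coe_pow, hd]
    change (d : ℂ) ^ 2 = (c : ℂ) ^ 2
    exact_mod_cast congrArg (fun x : ℝ => (x : ℂ)) h6
  obtain ⟨r, hr⟩ := (IsGalois.mem_bot_iff_fixed (x ^ 2)).mpr hfix
  refine ⟨r, ?_⟩
  have := congrArg Subtype.val hr
  have h : ((r : ℚ) : ℂ) = (c : ℂ) ^ 2 := this
  exact_mod_cast h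

end KummerDensity
end

/-! ### Which classes of $\Gamma(k)$ become trivial over $\mathbb{Q}(\zeta_k)$. -/

noncomputable section
namespace KummerDensity

theorem exists_squarefree_mul_sq {q : ℚ} (hq : 0 < q) :
    ∃ (η : ℕ) (s : ℚ), Squarefree η ∧ s ≠ 0 ∧ q = η * s ^ 2 := by
  obtain ⟨a, b, hab, ha⟩ := Nat.sq_mul_squarefree (q.num.natAbs * q.den)
  have hd : (q.den : ℚ) ≠ 0 := Nat.cast_ne_zero.mpr q.den_ne_zero
  have hnum : ((q.num.natAbs : ℕ) : ℚ) = q.num := by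
    rw [← Int.cast_natCast, Int.natAbs_of_nonneg (Rat.num_nonneg.mpr hq.le)]
  have hqe : q = a * (b / q.den) ^ 2 := by
    have h : (b : ℚ) ^ 2 * a = q.num * q.den := by
      rw [← hnum]; exact_mod_cast hab
    have h2 := Rat.num_div_den q
    rw [div_pow, mul_div_assoc', mul_comm, h, eq_div_iff (pow_ne_zero _ hd)]
    nth_rewrite 1 [← h2]
    field_simp
  refine ⟨a, b / q.den, ha, ?_, hqe⟩
  rintro h
  rw [h] at hqe
  simp at hqe
  exact hq.ne' hqe

theorem squarefree_eq_of_eq_mul_sq {η ξ : ℕ} (hη : Squarefree η) (hξ : Squarefree ξ) {y : ℚ}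
    (h : (η : ℚ) = ξ * y ^ 2) : η = ξ := by
  obtain ⟨B, rfl⟩ := exists_int_of_sq_mul_eq (q := y) (N := η) hξ (by
    push_cast; rw [h]; ring)
  have hB : ξ * B.natAbs ^ 2 = η := by
    zify
    rw [sq_abs]
    exact_mod_cast h.symm
  have h1 : B.natAbs = 1 := Nat.isUnit_iff.mp (hη B.natAbs ⟨ξ, by rw [← hB]; ring⟩)
  rw [← hB, h1]; ring

/-- `η` is squarefree, `η^l ∈ Γ · (ℚ^*)^{2l}` and `√η ∈ ℚ(ζ_{2l})`. -/
def Entangled (Γ : Subgroup ℚˣ) (l η : ℕ) : Prop :=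
  Squarefree η ∧ (∃ u ∈ Γ, ∃ x : ℚ, (u : ℚ) = (η : ℚ) ^ l * x ^ (2 * l)) ∧
    ∃ z ∈ cyc (2 * l), z ^ 2 = (η : ℂ)

/-- `η^l` as an element of `ℚ^* / (ℚ^*)^{2l}` (and `1` for `η = 0`). -/
def powClass (l η : ℕ) : ℚˣ ⧸ powers (2 * l) :=
  if h : (η : ℚ) = 0 then 1 else QuotientGroup.mk' (powers (2 * l)) (Units.mk0 (η : ℚ) h ^ l)

theorem mk_eq_powClass {l η : ℕ} (hl : l ≠ 0) (hη : η ≠ 0) {u : ℚˣ} {x : ℚ}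
    (h : (u : ℚ) = (η : ℚ) ^ l * x ^ (2 * l)) :
    QuotientGroup.mk' (powers (2 * l)) u = powClass l η := by
  have hx : x ≠ 0 := by
    rintro rfl
    rw [zero_pow (by omega), mul_zero] at h
    exact u.ne_zero h
  have hη0 : (η : ℚ) ≠ 0 := Nat.cast_ne_zero.mpr hη
  rw [powClass, dif_neg hη0, eq_comm, QuotientGroup.mk'_eq_mk']
  exact ⟨Units.mk0 x hx ^ (2 * l), ⟨Units.mk0 x hx, rfl⟩, Units.ext (by simp [h])⟩

/-- For surjectivity, the positive $2l$-th root $c$ of $u$ lies in $\mathbb{Q}(\zeta_{2l})$, so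
$r=c^2$ is rational and $u=r^l$; $\eta$ is the squarefree part of $r$. For injectivity, positivity
allows $l$-th roots to be taken in $\eta^l=\xi^ly^{2l}$. -/
theorem entangled_bijOn {Γ : Subgroup ℚˣ} (hpos : ∀ g ∈ Γ, 0 < (g : ℚ)) {l : ℕ} (hl : l ≠ 0) :
    Set.BijOn (powClass l) {η | Entangled Γ l η}
      ((cycPowers (2 * l) ⊓ Γ).map (QuotientGroup.mk' (powers (2 * l))) : Set _) := by
  have : NeZero (2 * l) := ⟨by omega⟩
  refine ⟨?_, ?_, ?_⟩
  · rintro η ⟨hsq, ⟨u, hu, x, hux⟩, z, hz, hzη⟩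
    refine ⟨u, ⟨⟨z * x, mul_mem hz ((cyc _).algebraMap_mem x), ?_⟩, hu⟩,
      mk_eq_powClass hl hsq.ne_zero hux⟩
    rw [mul_pow, pow_mul, hzη, hux]
    push_cast
    rfl
  · rintro η ⟨hη, -⟩ ξ ⟨hξ, -⟩ h
    have hη0 : (η : ℚ) ≠ 0 := Nat.cast_ne_zero.mpr hη.ne_zero
    have hξ0 : (ξ : ℚ) ≠ 0 := Nat.cast_ne_zero.mpr hξ.ne_zero
    rw [powClass, powClass, dif_neg hη0, dif_neg hξ0, eq_comm, QuotientGroup.mk'_eq_mk'] at h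
    obtain ⟨_, ⟨y, rfl⟩, hy⟩ := h
    have hy := congrArg Units.val hy
    simp only [powMonoidHom_apply, Units.val_mul, Units.val_pow_eq_pow_val, Units.val_mk0] at hy
    rw [pow_mul, ← mul_pow] at hy
    have := (pow_left_inj₀ (by positivity) (by positivity) hl).mp hy
    exact squarefree_eq_of_eq_mul_sq hη hξ this.symm
  · rintro _ ⟨u, ⟨⟨z, hz, hzu⟩, hu⟩, rfl⟩
    have hup := hpos u hu
    have hcp := posRoot_pow (k := 2 * l) (by omega) hup
    have hz0 : z ≠ 0 := by
      rintro rfl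
      rw [zero_pow (by omega), eq_comm, Rat.cast_eq_zero] at hzu
      exact u.ne_zero hzu
    have hc : posRoot (2 * l) u ∈ cyc (2 * l) := by
      have := mul_mem (div_mem_cyc hz0 (hcp.trans hzu.symm)) hz
      rwa [div_mul_cancel₀ _ hz0] at this
    obtain ⟨r, hr⟩ := exists_rat_eq_sq hc hcp
    have hrC : (r : ℂ) = posRoot (2 * l) u ^ 2 := by
      rw [posRoot, ← Complex.ofReal_pow, ← hr]; simp
    have hr0 : 0 < r := by
      have : (0 : ℝ) < r := by
        rw [hr]
        exact pow_pos (Real.rpow_pos_of_pos (by exact_mod_cast hup) _) 2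
      exact_mod_cast this
    have hur : (u : ℚ) = r ^ l := by
      have : ((u : ℚ) : ℂ) = (r : ℂ) ^ l := by rw [hrC, ← pow_mul, hcp]
      exact_mod_cast this
    obtain ⟨η, s, hη, hs, rfl⟩ := exists_squarefree_mul_sq hr0
    have hux : (u : ℚ) = (η : ℚ) ^ l * s ^ (2 * l) := by rw [hur, mul_pow, pow_mul]
    have hsC : (s : ℂ) ≠ 0 := Rat.cast_ne_zero.mpr hs
    refine ⟨η, ⟨hη, ⟨u, hu, s, hux⟩, posRoot (2 * l) u / s,
      div_mem hc ((cyc _).algebraMap_mem s), ?_⟩, (mk_eq_powClass hl hη.ne_zero hux).symm⟩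
    rw [div_pow, ← hrC]
    push_cast
    field_simp

/-- If $c^2$ is rational and $k=2j+1$, then $c=u/(c^2)^j$ is itself rational. -/
theorem card_map_of_odd {Γ : Subgroup ℚˣ} (hpos : ∀ g ∈ Γ, 0 < (g : ℚ)) {k : ℕ} (hk : Odd k) :
    Nat.card ((cycPowers k ⊓ Γ).map (QuotientGroup.mk' (powers k))) = 1 := by
  have hk0 : k ≠ 0 := by rintro rfl; simp at hk
  have : NeZero k := ⟨hk0⟩
  rw [← Subgroup.relIndex_ker, QuotientGroup.ker_mk', Subgroup.relIndex_eq_one]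
  rintro u ⟨⟨z, hz, hzu⟩, hu⟩
  have hup := hpos u hu
  have hcp := posRoot_pow hk0 hup
  have hz0 : z ≠ 0 := by
    rintro rfl
    rw [zero_pow hk0, eq_comm, Rat.cast_eq_zero] at hzu
    exact u.ne_zero hzu
  have hc : posRoot k u ∈ cyc k := by
    have := mul_mem (div_mem_cyc hz0 (hcp.trans hzu.symm)) hz
    rwa [div_mul_cancel₀ _ hz0] at this
  obtain ⟨r, hr⟩ := exists_rat_eq_sq hc hcp
  have hrC : (r : ℂ) = posRoot k u ^ 2 := by
    rw [posRoot, ← Complex.ofReal_pow, ← hr]; simp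
  have hrne : (r : ℂ) ≠ 0 := by rw [hrC]; exact pow_ne_zero _ (posRoot_ne_zero hup)
  obtain ⟨j, hj⟩ := hk
  have hx : posRoot k u = ((u / r ^ j : ℚ) : ℂ) := by
    push_cast
    rw [← hcp, hj, pow_succ, pow_mul, ← hj, ← hrC, mul_div_cancel_left₀ _ (pow_ne_zero _ hrne)]
  have hx0 : (u / r ^ j : ℚ) ≠ 0 := by
    intro h
    rw [h] at hx
    exact posRoot_ne_zero hup (by simpa using hx)
  refine ⟨Units.mk0 _ hx0, Units.ext ?_⟩
  rw [hx] at hcp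
  change (u / r ^ j : ℚ) ^ k = u
  exact_mod_cast hcp

/-- The valuation is $l(1+2v_p(x))$, with an odd second factor. This forces an entangled $\eta$ to
divide $\sigma_\Gamma$. -/
theorem padicValRat_pow_mul_pow_ne_zero {p l η : ℕ} [Fact p.Prime] (hl : l ≠ 0)
    (hη : Squarefree η) (hp : p ∣ η) {u x : ℚ} (hu : u ≠ 0) (h : u = (η : ℚ) ^ l * x ^ (2 * l)) :
    padicValRat p u ≠ 0 := by
  have hη0 : (η : ℚ) ≠ 0 := Nat.cast_ne_zero.mpr hη.ne_zero
  have hx : x ≠ 0 := by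
    rintro rfl
    rw [zero_pow (by omega), mul_zero] at h
    exact hu h
  have hv : padicValNat p η = 1 := by
    apply le_antisymm
    · by_contra h2
      have := hη p (by
        rw [← sq]
        exact (padicValNat_dvd_iff_le hη.ne_zero).mpr (by omega))
      exact (Fact.out : p.Prime).one_lt.ne' (Nat.isUnit_iff.mp this)
    · exact one_le_padicValNat_of_dvd hη.ne_zero hp
  rw [h, padicValRat.mul (pow_ne_zero _ hη0) (pow_ne_zero _ hx), padicValRat.pow,
    padicValRat.pow, padicValRat.of_nat, hv]
  intro h0
  push_cast at h0
  have hl' : (l : ℤ) ≠ 0 := by exact_mod_cast hl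
  have : (l : ℤ) * (1 + 2 * padicValRat p x) = 0 := by linarith
  rcases mul_eq_zero.mp this with h | h
  · exact hl' h
  · omega

/-- Finiteness makes `sigma` the genuine product; `finprod` defaults to 1 over an infinite support.
-/
theorem finite_supp {Γ : Subgroup ℚˣ} (hfg : Γ.FG) : (supp Γ).Finite := by
  obtain ⟨S, rfl⟩ := hfg
  have hfin : (⋃ g ∈ S, ((g : ℚ).num.natAbs.primeFactors ∪ (g : ℚ).den.primeFactors : Set ℕ)).Finite :=
    S.finite_toSet.biUnion fun g _ => (Finset.finite_toSet _).union (Finset.finite_toSet _)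
  refine hfin.subset ?_
  rintro p ⟨hp, g, hg, hv⟩
  have : Fact p.Prime := ⟨hp⟩
  by_contra hmem
  refine hv ?_
  clear hv
  induction hg using Subgroup.closure_induction with
  | mem g hg =>
    simp only [Set.mem_iUnion, not_exists] at hmem
    have h := hmem g hg
    simp only [Set.mem_union, Finset.mem_coe, Nat.mem_primeFactors, hp, true_and, not_or,
      not_and_or, not_not] at h
    have h1 : ¬ p ∣ (g : ℚ).num.natAbs := by simpa using h.1
    have h2 : ¬ p ∣ (g : ℚ).den := by simpa using h.2
    rw [padicValRat, padicValInt, padicValNat.eq_zero_of_not_dvd h1,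
      padicValNat.eq_zero_of_not_dvd h2]
    simp
  | one => simp
  | mul x y _ _ hx hy =>
    rw [Units.val_mul, padicValRat.mul x.ne_zero y.ne_zero, hx, hy, add_zero]
  | inv x _ hx =>
    rw [Units.val_inv_eq_inv_val, padicValRat.inv, hx, neg_zero]

theorem sigma_eq_prod {Γ : Subgroup ℚˣ} (hfg : Γ.FG) :
    sigma Γ = ∏ p ∈ (finite_supp hfg).toFinset, p :=
  finprod_mem_eq_finite_toFinset_prod _ _

theorem squarefree_sigma {Γ : Subgroup ℚˣ} (hfg : Γ.FG) : Squarefree (sigma Γ) := by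
  rw [sigma_eq_prod hfg]
  refine Finset.squarefree_prod_of_pairwise_isCoprime ?_ ?_
  · intro p hp q hq hpq
    rw [Finset.mem_coe, Set.Finite.mem_toFinset] at hp hq
    exact Nat.coprime_iff_isRelPrime.mp ((Nat.coprime_primes hp.1 hq.1).mpr hpq)
  · intro p hp
    rw [Set.Finite.mem_toFinset] at hp
    exact hp.1.prime.squarefree

theorem prime_dvd_sigma {Γ : Subgroup ℚˣ} (hfg : Γ.FG) {p : ℕ} (hp : p ∈ supp Γ) :
    p ∣ sigma Γ := by
  rw [sigma_eq_prod hfg]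
  exact Finset.dvd_prod_of_mem _ ((finite_supp hfg).mem_toFinset.mpr hp)

theorem powerMem_iff {Γ : Subgroup ℚˣ} {η : ℕ} (hη : η ≠ 0) (s : ℕ) :
    PowerMem Γ η s ↔ ∃ u ∈ Γ, ∃ x : ℚ, (u : ℚ) = (η : ℚ) ^ 2 ^ s * x ^ 2 ^ (s + 1) := by
  have hη0 : (η : ℚ) ≠ 0 := Nat.cast_ne_zero.mpr hη
  constructor
  · rintro ⟨v, hv, w, hw, hwv⟩
    rw [eq_comm, QuotientGroup.mk'_eq_mk'] at hwv
    obtain ⟨_, ⟨y, rfl⟩, hy⟩ := hwv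
    refine ⟨w, hw, y, ?_⟩
    rw [← hy]
    simp [hv]
  · rintro ⟨u, hu, x, hx⟩
    have hx0 : x ≠ 0 := by
      rintro rfl
      rw [zero_pow (by positivity), mul_zero] at hx
      exact u.ne_zero hx
    refine ⟨Units.mk0 (η : ℚ) hη0 ^ 2 ^ s, by simp, u, hu, ?_⟩
    rw [eq_comm, QuotientGroup.mk'_eq_mk']
    exact ⟨Units.mk0 x hx0 ^ 2 ^ (s + 1), ⟨Units.mk0 x hx0, rfl⟩, Units.ext (by simp [hx])⟩

/-- By monotonicity, $t_\eta\le s$ is equivalent to membership at level $s$ itself. -/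
theorem powerMem_mono {Γ : Subgroup ℚˣ} {η : ℕ} (hη : η ≠ 0) {s s' : ℕ} (hs : s ≤ s')
    (h : PowerMem Γ η s) : PowerMem Γ η s' := by
  rw [powerMem_iff hη] at *
  obtain ⟨d, rfl⟩ := Nat.exists_eq_add_of_le hs
  obtain ⟨u, hu, x, hx⟩ := h
  refine ⟨u ^ 2 ^ d, pow_mem hu _, x, ?_⟩
  rw [Units.val_pow_eq_pow_val, hx, mul_pow, ← pow_mul, ← pow_mul, ← pow_add, ← pow_add]
  congr 3
  omega

theorem tExp_le_iff {Γ : Subgroup ℚˣ} {η : ℕ} (hη : η ≠ 0) (s : ℕ) :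
    tExp Γ η ≤ s ↔ PowerMem Γ η s := by
  classical
  unfold tExp
  split_ifs with h
  · rw [Nat.cast_le]
    exact ⟨fun hs => powerMem_mono hη hs (Nat.find_spec h), fun hs => Nat.find_min' h hs⟩
  · exact ⟨fun hs => absurd hs (by simp), fun hs => absurd ⟨s, hs⟩ h⟩

/-- The odd part $m=2j+1$ is immaterial: $\eta^{2^sm}$ and $\eta^{2^s}$ differ by
$(\eta^j)^{2^{s+1}}$, and conversely one raises to the $m$-th power. -/
theorem exists_pow_iff_powerMem {Γ : Subgroup ℚˣ} {η : ℕ} (hη : η ≠ 0) (s : ℕ) {m : ℕ}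
    (hm : Odd m) :
    (∃ u ∈ Γ, ∃ x : ℚ, (u : ℚ) = (η : ℚ) ^ (2 ^ s * m) * x ^ (2 * (2 ^ s * m))) ↔
      PowerMem Γ η s := by
  rw [powerMem_iff hη]
  constructor
  · rintro ⟨u, hu, x, hx⟩
    obtain ⟨j, rfl⟩ := hm
    exact ⟨u, hu, η ^ j * x ^ (2 * j + 1), by rw [hx]; ring⟩
  · rintro ⟨u, hu, x, hx⟩
    exact ⟨u ^ m, pow_mem hu _, x, by rw [Units.val_pow_eq_pow_val, hx]; ring⟩

theorem one_le_gammaExp (Γ : Subgroup ℚˣ) (η : ℤ) : 1 ≤ gammaExp Γ η :=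
  le_max_of_le_left le_self_add

theorem gammaExp_le_iff {Γ : Subgroup ℚˣ} {η : ℕ} (hη : Squarefree η) (h1 : η ≠ 1) (s : ℕ) :
    gammaExp Γ η ≤ ((s + 1 : ℕ) : ℕ∞) ↔ PowerMem Γ η s ∧ twoExp η ≤ s + 1 := by
  have hd : fieldDisc (((η : ℕ) : ℤ) : ℚ) = fieldDisc (η : ℚ) := by rw [Int.cast_natCast]
  rw [gammaExp, max_le_iff, hd, padicValInt_fieldDisc hη h1, Nat.cast_le, ← tExp_le_iff hη.ne_zero,
    Nat.cast_add, Nat.cast_one, add_comm (s : ℕ∞) 1]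
  rw [ENat.add_le_add_iff_left (by simp)]

theorem powerMem_one (Γ : Subgroup ℚˣ) (s : ℕ) : PowerMem Γ (1 : ℕ) s := by
  rw [powerMem_iff one_ne_zero]
  exact ⟨1, one_mem _, 1, by simp⟩

/-- The conditions `v_2(k) ≥ γ_η` and `p ∣ k` for all primes `p ∣ 2η`. -/
def Meets (Γ : Subgroup ℚˣ) (k η : ℕ) : Prop :=
  gammaExp Γ η ≤ (padicValNat 2 k : ℕ∞) ∧ ∀ p ∈ (2 * η).primeFactors, p ∣ k

open Classical in
/-- The `η` dividing `σ_Γ` which contribute to the degree of `ℚ(ζ_k, Γ^{1/k})`. -/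
def entangledDivisors (Γ : Subgroup ℚˣ) (k : ℕ) : Finset ℕ :=
  {η ∈ (sigma Γ).divisors | η = 1 ∨ Meets Γ k η}

theorem mem_entangledDivisors {Γ : Subgroup ℚˣ} {k η : ℕ} :
    η ∈ entangledDivisors Γ k ↔ (η ∣ sigma Γ ∧ sigma Γ ≠ 0) ∧ (η = 1 ∨ Meets Γ k η) := by
  classical
  rw [entangledDivisors, Finset.mem_filter, Nat.mem_divisors]

/-- With $k=2\cdot2^sm$ one has $v_2(k)=s+1$, matching the shift in $\gamma_\eta\ge1+t_\eta$. The
case $\eta=1$ is separate because the discriminant formula excludes it. -/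
theorem entangled_iff {Γ : Subgroup ℚˣ} (hfg : Γ.FG) (s : ℕ) {m : ℕ} (hm : Odd m) (η : ℕ) :
    Entangled Γ (2 ^ s * m) η ↔ η ∈ entangledDivisors Γ (2 * (2 ^ s * m)) := by
  have hm0 : m ≠ 0 := by rintro rfl; simp at hm
  have hl : 2 ^ s * m ≠ 0 := mul_ne_zero (by positivity) hm0
  have : NeZero (2 * (2 ^ s * m)) := ⟨mul_ne_zero two_ne_zero hl⟩
  have hσ := (squarefree_sigma hfg)
  have hv : padicValNat 2 (2 * (2 ^ s * m)) = s + 1 := by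
    rw [← mul_assoc, ← pow_succ', padicValNat.mul (by positivity) hm0, padicValNat.prime_pow,
      padicValNat.eq_zero_of_not_dvd (fun h => absurd hm (Nat.not_odd_iff_even.mpr
        (even_iff_two_dvd.mpr h))), add_zero]
  have hpow : ∀ e, 2 ^ e ∣ 2 * (2 ^ s * m) ↔ e ≤ s + 1 := fun e => by
    rw [padicValNat_dvd_iff_le (NeZero.ne _), hv]
  rw [mem_entangledDivisors, Meets, hv]
  constructor
  · rintro ⟨hη, ⟨u, hu, x, hx⟩, hz⟩
    have hησ : η ∣ sigma Γ := dvd_of_squarefree_of_primes hη fun p hp hpη => by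
      have : Fact p.Prime := ⟨hp⟩
      exact prime_dvd_sigma hfg
        ⟨hp, u, hu, padicValRat_pow_mul_pow_ne_zero hl hη hpη u.ne_zero hx⟩
    refine ⟨⟨hησ, hσ.ne_zero⟩, ?_⟩
    by_cases h1 : η = 1
    · exact Or.inl h1
    refine Or.inr ?_
    rw [gammaExp_le_iff hη h1]
    obtain ⟨hodd, htwo⟩ := (exists_sq_mem_cyc_iff hη).mp hz
    refine ⟨⟨(exists_pow_iff_powerMem hη.ne_zero s hm).mp ⟨u, hu, x, hx⟩, (hpow _).mp htwo⟩, ?_⟩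
    intro p hp
    rw [Nat.mem_primeFactors] at hp
    obtain ⟨hp, hpη, -⟩ := hp
    by_cases hp2 : p = 2
    · rw [hp2]; exact dvd_mul_right _ _
    · rcases hp.dvd_mul.mp hpη with h | h
      · exact absurd ((Nat.prime_dvd_prime_iff_eq hp Nat.prime_two).mp h) hp2
      · exact hodd p hp hp2 h
  · rintro ⟨⟨hησ, -⟩, h⟩
    have hη := hσ.squarefree_of_dvd hησ
    by_cases h1 : η = 1
    · subst h1
      exact ⟨hη, (exists_pow_iff_powerMem one_ne_zero s hm).mpr (powerMem_one Γ s), 1, one_mem _,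
        by simp⟩
    rw [gammaExp_le_iff hη h1] at h
    obtain ⟨⟨hpm, htwo⟩, hdvd⟩ := h.resolve_left h1
    refine ⟨hη, (exists_pow_iff_powerMem hη.ne_zero s hm).mpr hpm,
      (exists_sq_mem_cyc_iff hη).mpr ⟨fun p hp _ hpη => hdvd p ?_, (hpow _).mpr htwo⟩⟩
    exact Nat.mem_primeFactors.mpr ⟨hp, hpη.mul_left _, mul_ne_zero two_ne_zero hη.ne_zero⟩

theorem card_entangledDivisors {Γ : Subgroup ℚˣ} (hfg : Γ.FG) (hpos : ∀ g ∈ Γ, 0 < (g : ℚ))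
    {k : ℕ} (hk : k ≠ 0) :
    Nat.card ((cycPowers k ⊓ Γ).map (QuotientGroup.mk' (powers k))) =
      (entangledDivisors Γ k).card := by
  rcases Nat.even_or_odd k with he | ho
  · obtain ⟨l, rfl⟩ := he.two_dvd
    have hl : l ≠ 0 := by rintro rfl; simp at hk
    obtain ⟨s, m, hm, rfl⟩ := Nat.exists_eq_two_pow_mul_odd hl
    have h := entangled_bijOn hpos hl
    have e : {η | Entangled Γ (2 ^ s * m) η} = (entangledDivisors Γ (2 * (2 ^ s * m)) : Set ℕ) := by
      ext η
      exact entangled_iff hfg s hm η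
    rw [e] at h
    have h := Nat.card_congr (Set.BijOn.equiv _ h)
    rw [Nat.card_coe_set_eq, Set.ncard_coe_finset] at h
    exact h.symm
  · rw [card_map_of_odd hpos ho]
    -- For odd $k$ no `Meets` condition can hold, since $\gamma_\eta\ge1>v_2(k)$.
    have : entangledDivisors Γ k = {1} := by
      ext η
      rw [mem_entangledDivisors, Meets, Finset.mem_singleton,
        padicValNat.eq_zero_of_not_dvd (fun h => absurd ho (Nat.not_odd_iff_even.mpr
          (even_iff_two_dvd.mpr h)))]
      constructor
      · rintro ⟨-, h | ⟨h, -⟩⟩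
        · exact h
        · exact absurd ((one_le_gammaExp Γ η).trans h) (by simp)
      · rintro rfl
        exact ⟨⟨one_dvd _, (squarefree_sigma hfg).ne_zero⟩, Or.inl rfl⟩
    rw [this, Finset.card_singleton]

/-- The degree of `ℚ(ζ_k, Γ^{1/k})`. -/
theorem finrank_kummerField_mul_card {Γ : Subgroup ℚˣ} (hfg : Γ.FG)
    (hpos : ∀ g ∈ Γ, 0 < (g : ℚ)) {k : ℕ} (hk : k ≠ 0) :
    Module.finrank ℚ (kummerField Γ k) * (entangledDivisors Γ k).card =
      k.totient * Nat.card (GammaMod Γ k) := by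
  have : NeZero k := ⟨hk⟩
  rw [← card_entangledDivisors hfg hpos hk, finrank_mul_card hpos]

end KummerDensity
end

/-! ### Finiteness, multiplicativity and growth of $|\Gamma(k)|$. -/

noncomputable section
namespace KummerDensity

theorem finite_GammaMod {Γ : Subgroup ℚˣ} (hfg : Γ.FG) {k : ℕ} (hk : k ≠ 0) :
    Finite (GammaMod Γ k) := by
  have : Group.FG Γ := (Group.fg_iff_subgroup_fg Γ).mpr hfg
  have : Group.FG (GammaMod Γ k) :=
    Group.fg_of_surjective ((QuotientGroup.mk' (powers k)).subgroupMap_surjective Γ)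
  refine CommGroup.finite_of_fg_isMulTorsion _ ?_
  rintro ⟨_, g, hg, rfl⟩
  rw [isOfFinOrder_iff_pow_eq_one]
  refine ⟨k, Nat.pos_of_ne_zero hk, Subtype.ext ?_⟩
  exact (QuotientGroup.eq_one_iff (g ^ k)).mpr ⟨g, rfl⟩

theorem card_GammaMod_pos {Γ : Subgroup ℚˣ} (hfg : Γ.FG) {k : ℕ} (hk : k ≠ 0) :
    0 < Nat.card (GammaMod Γ k) := by
  have := finite_GammaMod hfg hk
  exact Nat.card_pos

theorem card_GammaMod_one (Γ : Subgroup ℚˣ) : Nat.card (GammaMod Γ 1) = 1 := by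
  rw [card_GammaMod, Subgroup.relIndex_eq_one]
  exact fun g _ => ⟨g, by simp⟩

theorem exists_eq_pow_mul_pow {G : Type*} [CommGroup G] {m n : ℕ} (h : m.Coprime n) (g : G) :
    ∃ u v : ℤ, g = (g ^ u) ^ m * (g ^ v) ^ n := by
  obtain ⟨u, v, huv⟩ := Nat.isCoprime_iff_coprime.mpr h
  refine ⟨u, v, ?_⟩
  rw [← zpow_natCast, ← zpow_natCast, ← zpow_mul, ← zpow_mul, ← zpow_add, huv, zpow_one]

theorem powers_inf_powers {m n : ℕ} (h : m.Coprime n) :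
    powers m ⊓ powers n = powers (m * n) := by
  apply le_antisymm
  · rintro g ⟨⟨x, hx⟩, ⟨y, hy⟩⟩
    obtain ⟨u, v, huv⟩ := exists_eq_pow_mul_pow h g
    simp only [powMonoidHom_apply] at hx hy
    refine ⟨y ^ u * x ^ v, ?_⟩
    rw [powMonoidHom_apply, huv]
    nth_rewrite 1 [← hy]
    nth_rewrite 1 [← hx]
    rw [mul_pow, pow_mul, ← zpow_natCast, ← zpow_natCast, ← zpow_natCast, ← zpow_natCast,
      ← zpow_natCast, ← zpow_natCast, ← zpow_natCast]
    simp only [← zpow_mul]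
    congr 2 <;> (push_cast; ring)
  · rintro _ ⟨x, rfl⟩
    exact ⟨⟨x ^ n, by simp [← pow_mul, mul_comm]⟩, ⟨x ^ m, by simp [← pow_mul]⟩⟩

/-- By Bézout every $g\in\Gamma$ is an $n$-th power from $\Gamma$ times an $m$-th power, so
intersecting $\Gamma$ with `powers n` does not change the index of `powers m`. -/
theorem card_GammaMod_mul (Γ : Subgroup ℚˣ) {m n : ℕ} (h : m.Coprime n) :
    Nat.card (GammaMod Γ (m * n)) = Nat.card (GammaMod Γ m) * Nat.card (GammaMod Γ n) := by
  rw [card_GammaMod, card_GammaMod, card_GammaMod, ← powers_inf_powers h,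
    ← Subgroup.relIndex_inf_mul_relIndex]
  congr 1
  rw [← Subgroup.relIndex_sup_right (powers n ⊓ Γ), ← Subgroup.relIndex_sup_right Γ]
  congr 1
  apply le_antisymm (sup_le_sup_right inf_le_right _)
  refine sup_le (fun g hg => ?_) le_sup_right
  obtain ⟨u, v, huv⟩ := exists_eq_pow_mul_pow h g
  rw [huv, mul_comm]
  exact Subgroup.mul_mem_sup ⟨⟨g ^ v, rfl⟩, pow_mem (zpow_mem hg _) _⟩ ⟨g ^ u, rfl⟩

theorem exists_padicValRat_ne_zero {g : ℚ} (hg : 0 < g) (h1 : g ≠ 1) :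
    ∃ p : ℕ, p.Prime ∧ padicValRat p g ≠ 0 := by
  by_cases hn : g.num.natAbs = 1
  · have hd : g.den ≠ 1 := by
      intro hd
      have h0 := Rat.num_pos.mpr hg
      refine h1 (Rat.ext ?_ ?_)
      · rw [Rat.num_one]; omega
      · rw [Rat.den_one, hd]
    obtain ⟨p, hp, hpd⟩ := Nat.exists_prime_and_dvd hd
    have : Fact p.Prime := ⟨hp⟩
    refine ⟨p, hp, ?_⟩
    have := one_le_padicValNat_of_dvd g.den_ne_zero hpd
    rw [padicValRat, padicValInt, hn, padicValNat_one_right]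
    omega
  · obtain ⟨p, hp, hpn⟩ := Nat.exists_prime_and_dvd hn
    have : Fact p.Prime := ⟨hp⟩
    refine ⟨p, hp, ?_⟩
    have h2 : ¬ p ∣ g.den := fun h => Nat.not_coprime_of_dvd_of_dvd hp.one_lt hpn h g.reduced
    have := one_le_padicValNat_of_dvd (Int.natAbs_ne_zero.mpr (Rat.num_ne_zero.mpr hg.ne')) hpn
    rw [padicValRat, padicValInt, padicValNat.eq_zero_of_not_dvd h2]
    omega

/-- `|Γ(k)|` grows at least linearly in `k`. -/
theorem exists_le_mul_card_GammaMod {Γ : Subgroup ℚˣ} (hfg : Γ.FG)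
    (hpos : ∀ g ∈ Γ, 0 < (g : ℚ)) (hne : Γ ≠ ⊥) :
    ∃ n : ℕ, ∀ k : ℕ, k ≠ 0 → k ≤ n * Nat.card (GammaMod Γ k) := by
  obtain ⟨g, hg, hg1⟩ := Γ.bot_or_exists_ne_one.resolve_left hne
  obtain ⟨p, hp, hv⟩ := exists_padicValRat_ne_zero (hpos g hg)
    fun h => hg1 (Units.ext h)
  have : Fact p.Prime := ⟨hp⟩
  -- With $N=|\Gamma(k)|$, $g^N$ is a $k$-th power in $\mathbb{Q}^*$, so $k\mid N\,v_p(g)$ with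
  -- $v_p(g)\ne0$.
  refine ⟨(padicValRat p (g : ℚ)).natAbs, fun k hk => ?_⟩
  have hcard := card_GammaMod_pos hfg hk
  set N := Nat.card (GammaMod Γ k)
  have hpow : (⟨QuotientGroup.mk' (powers k) g, Subgroup.mem_map_of_mem _ hg⟩ : GammaMod Γ k) ^ N
      = 1 := pow_card_eq_one'
  have hpow := congrArg Subtype.val hpow
  obtain ⟨x, hx⟩ := (QuotientGroup.eq_one_iff (g ^ N)).mp hpow
  have hx : (x : ℚ) ^ k = (g : ℚ) ^ N := congrArg Units.val hx
  have hval := congrArg (padicValRat p) hx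
  rw [padicValRat.pow, padicValRat.pow] at hval
  apply Nat.le_of_dvd
  · exact Nat.mul_pos (Int.natAbs_pos.mpr hv) hcard
  · rw [← Int.natCast_dvd_natCast, Nat.cast_mul, Int.natCast_natAbs, mul_comm]
    have : (k : ℤ) ∣ (N : ℤ) * padicValRat p (g : ℚ) := ⟨_, hval.symm⟩
    rcases abs_choice (padicValRat p (g : ℚ)) with h | h <;> rw [h]
    · exact this
    · rw [mul_neg]; exact this.neg_right

end KummerDensity
end

/-! ### Euler products restricted by lower bounds on valuations. -/

noncomputable section
namespace KummerDensity

section EulerProduct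

variable {f : ℕ → ℝ}

/-- The local factor at `p` of an Euler product. -/
def localFactor (f : ℕ → ℝ) (p : ℕ) : ℝ := ∑' e, f (p ^ e)

open Classical in
/-- The part of the local factor at `p` with exponents at least `γ`. -/
def localTail (f : ℕ → ℝ) (p : ℕ) (γ : ℕ∞) : ℝ := ∑' e : ℕ, if γ ≤ e then f (p ^ e) else 0

theorem summable_comp_prime_pow (hf : Summable f) {p : ℕ} (hp : p.Prime) :
    Summable fun e : ℕ => f (p ^ e) :=
  hf.comp_injective (Nat.pow_right_injective hp.two_le)

open Classical in
/-- The restriction of `f` to integers whose `q`-adic valuation is less than `γ`. -/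
def truncAt (f : ℕ → ℝ) (q : ℕ) (γ : ℕ∞) (k : ℕ) : ℝ :=
  if (padicValNat q k : ℕ∞) < γ then f k else 0

theorem truncAt_mul (hmul : ∀ {m n : ℕ}, m.Coprime n → f (m * n) = f m * f n) (hf0 : f 0 = 0)
    {q : ℕ} (hq : q.Prime) {γ : ℕ∞} (hγ : 1 ≤ γ) {m n : ℕ} (h : m.Coprime n) :
    truncAt f q γ (m * n) = truncAt f q γ m * truncAt f q γ n := by
  have : Fact q.Prime := ⟨hq⟩
  have h0 : (0 : ℕ∞) < γ := lt_of_lt_of_le one_pos hγ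
  by_cases hm : m = 0
  · subst hm; simp [truncAt, hf0]
  by_cases hn : n = 0
  · subst hn; simp [truncAt, hf0]
  unfold truncAt
  rw [padicValNat.mul hm hn, hmul h]
  have : padicValNat q m = 0 ∨ padicValNat q n = 0 := by
    by_contra hc
    push Not at hc
    exact Nat.not_coprime_of_dvd_of_dvd hq.one_lt (dvd_of_one_le_padicValNat (by omega))
      (dvd_of_one_le_padicValNat (by omega)) h
  rcases this with h' | h'
  · simp [h', h0]
  · simp [h', h0]

theorem summable_truncAt (hf : Summable f) (q : ℕ) (γ : ℕ∞) : Summable (truncAt f q γ) := by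
  refine Summable.of_norm_bounded hf.norm fun k => ?_
  unfold truncAt
  split_ifs <;> simp

theorem truncAt_prime_pow_of_ne {p q : ℕ} (hp : p.Prime) (hq : q.Prime) (hpq : p ≠ q) {γ : ℕ∞}
    (hγ : 1 ≤ γ) (e : ℕ) : truncAt f q γ (p ^ e) = f (p ^ e) := by
  have h0 : (0 : ℕ∞) < γ := lt_of_lt_of_le one_pos hγ
  rw [truncAt, padicValNat.eq_zero_of_not_dvd, if_pos (by simpa using h0)]
  intro h
  exact hpq ((Nat.prime_dvd_prime_iff_eq hq hp).mp (hq.dvd_of_dvd_pow h)).symm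

theorem localFactor_truncAt_self (hf : Summable f) {q : ℕ} (hq : q.Prime) (γ : ℕ∞) :
    localFactor (truncAt f q γ) q = localFactor f q - localTail f q γ := by
  have : Fact q.Prime := ⟨hq⟩
  have h1 := summable_comp_prime_pow hf hq
  have h2 : Summable fun e : ℕ => if γ ≤ e then f (q ^ e) else 0 := by
    refine Summable.of_norm_bounded h1.norm fun e => ?_
    split_ifs <;> simp
  classical
  have key : ∀ e : ℕ, truncAt f q γ (q ^ e) = f (q ^ e) - if γ ≤ e then f (q ^ e) else 0 := by
    intro e
    rw [truncAt, padicValNat.prime_pow]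
    by_cases h : γ ≤ (e : ℕ∞)
    · rw [if_pos h, if_neg (not_lt.mpr h), sub_self]
    · rw [if_neg h, if_pos (not_le.mp h), sub_zero]
  rw [localFactor, localFactor, localTail, tsum_congr key]
  convert! h1.tsum_sub h2 using 3

/-- Truncation preserves multiplicativity and alters only the Euler factor at $q$, from which it
subtracts the tail. Since $\gamma\ge1$, the value at 1 survives. -/
theorem tsum_truncAt (hf1 : f 1 = 1) (hmul : ∀ {m n : ℕ}, m.Coprime n → f (m * n) = f m * f n)
    (hf : Summable f) (hf0 : f 0 = 0) {q : ℕ} (hq : q.Prime) {γ : ℕ∞} (hγ : 1 ≤ γ)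
    (hA : localFactor f q ≠ 0) :
    ∑' k, truncAt f q γ k = (∑' k, f k) * (1 - localTail f q γ / localFactor f q) := by
  classical
  have h0 : (0 : ℕ∞) < γ := lt_of_lt_of_le one_pos hγ
  have e1 : HasProd (fun p : Nat.Primes => localFactor f p) (∑' k, f k) :=
    EulerProduct.eulerProduct_hasProd hf1 hmul hf.norm hf0
  have e2 : HasProd (fun p : Nat.Primes => localFactor (truncAt f q γ) p)
      (∑' k, truncAt f q γ k) :=
    EulerProduct.eulerProduct_hasProd (by simp [truncAt, h0, hf1]) (truncAt_mul hmul hf0 hq hγ)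
      (summable_truncAt hf q γ).norm (by simp [truncAt, hf0])
  have e3 : HasProd (fun p : Nat.Primes => if p = ⟨q, hq⟩ then
      1 - localTail f q γ / localFactor f q else 1) (1 - localTail f q γ / localFactor f q) :=
    hasProd_ite_eq _ _
  refine e2.unique ?_
  convert! e1.mul e3 using 2 with p
  by_cases hp : p = ⟨q, hq⟩
  · rw [if_pos hp, hp]
    change localFactor _ q = localFactor _ q * _
    rw [localFactor_truncAt_self hf hq, mul_sub, mul_div_cancel₀ _ hA, mul_one]
  · rw [if_neg hp, mul_one]
    exact tsum_congr fun e => truncAt_prime_pow_of_ne p.2 hq (fun h => hp (Subtype.ext h)) hγ e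

open Classical in
/-- An Euler product over the integers `k` satisfying `γ_p ≤ v_p(k)` for all `p` in a finite set. -/
theorem tsum_mul_prod_ite {f : ℕ → ℝ} (hf1 : f 1 = 1)
    (hmul : ∀ {m n : ℕ}, m.Coprime n → f (m * n) = f m * f n)
    (hf : Summable f) (hf0 : f 0 = 0) (P : Finset ℕ) (hP : ∀ p ∈ P, p.Prime) (γ : ℕ → ℕ∞)
    (hγ : ∀ p, 1 ≤ γ p) (hA : ∀ p ∈ P, localFactor f p ≠ 0) :
    ∑' k, f k * ∏ p ∈ P, (if γ p ≤ (padicValNat p k : ℕ∞) then (1 : ℝ) else 0) =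
      (∑' k, f k) * ∏ p ∈ P, localTail f p (γ p) / localFactor f p := by
  -- The condition at $q$ is removed by subtracting `truncAt f q (γ q)` from $f$. The truncation
  -- satisfies the same hypotheses, so the induction must allow $f$ to vary.
  induction P using Finset.induction_on generalizing f with
  | empty => simp
  | insert q P hqP ih =>
    have hq := hP q (Finset.mem_insert_self _ _)
    have hP' : ∀ p ∈ P, p.Prime := fun p hp => hP p (Finset.mem_insert_of_mem hp)
    have hne : ∀ p ∈ P, p ≠ q := fun p hp h => hqP (h ▸ hp)
    have hsum : ∀ {g : ℕ → ℝ}, Summable g → Summable fun k =>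
        g k * ∏ p ∈ P, (if γ p ≤ (padicValNat p k : ℕ∞) then (1 : ℝ) else 0) := fun {g} hg => by
      refine Summable.of_norm_bounded hg.norm fun k => ?_
      rw [norm_mul, norm_prod]
      refine mul_le_of_le_one_right (norm_nonneg _) (Finset.prod_le_one (fun _ _ => norm_nonneg _)
        fun p _ => ?_)
      split_ifs <;> simp
    have hA' : ∀ p ∈ P, localFactor f p ≠ 0 := fun p hp => hA p (Finset.mem_insert_of_mem hp)
    have hAq := hA q (Finset.mem_insert_self _ _)
    have hfac : ∀ p ∈ P, localFactor (truncAt f q (γ q)) p = localFactor f p := fun p hp =>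
      tsum_congr fun e => truncAt_prime_pow_of_ne (hP' p hp) hq (hne p hp) (hγ q) e
    have htail : ∀ p ∈ P, localTail (truncAt f q (γ q)) p (γ p) = localTail f p (γ p) :=
      fun p hp => tsum_congr fun e => by
        rw [truncAt_prime_pow_of_ne (hP' p hp) hq (hne p hp) (hγ q) e]
    have hγ0 : (0 : ℕ∞) < γ q := lt_of_lt_of_le one_pos (hγ q)
    have ih1 := ih hf1 hmul hf hf0 hP' hA'
    have ih2 := ih (f := truncAt f q (γ q)) (by simp [truncAt, hγ0, hf1])
      (truncAt_mul hmul hf0 hq (hγ q)) (summable_truncAt hf q _) (by simp [truncAt, hf0]) hP'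
      (fun p hp => by rw [hfac p hp]; exact hA' p hp)
    rw [Finset.prod_congr rfl fun p hp => by rw [hfac p hp, htail p hp],
      tsum_truncAt hf1 hmul hf hf0 hq (hγ q) hAq] at ih2
    have key : ∀ k, f k * ∏ p ∈ insert q P, (if γ p ≤ (padicValNat p k : ℕ∞) then (1 : ℝ) else 0) =
        f k * ∏ p ∈ P, (if γ p ≤ (padicValNat p k : ℕ∞) then (1 : ℝ) else 0) -
        truncAt f q (γ q) k *
          ∏ p ∈ P, (if γ p ≤ (padicValNat p k : ℕ∞) then (1 : ℝ) else 0) := fun k => by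
      rw [Finset.prod_insert hqP, truncAt]
      by_cases h : γ q ≤ (padicValNat q k : ℕ∞)
      · rw [if_pos h, if_neg (not_lt.mpr h)]; ring
      · rw [if_neg h, if_pos (not_le.mp h)]; ring
    rw [tsum_congr key, (hsum hf).tsum_sub (hsum (summable_truncAt hf q _)), ih1, ih2,
      Finset.prod_insert hqP]
    ring

end EulerProduct

end KummerDensity
end

/-! ### The multiplicative generic term and its local factors. -/

noncomputable section
namespace KummerDensity

/-- On odd prime powers this reduces to $(p-1)^2\ge p$, true for $p\ge3$; the prime 2 costs the
factor 2 in `le_two_mul_totient_sq`. -/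
theorem le_totient_sq_of_odd {k : ℕ} (hk : Odd k) : k ≤ k.totient ^ 2 := by
  induction k using Nat.recOnPosPrimePosCoprime with
  | zero => simp
  | one => simp
  | prime_pow p n hp hn =>
    have hp3 : 3 ≤ p := by
      have : p ≠ 2 := by
        rintro rfl
        exact absurd hk (Nat.not_odd_iff_even.mpr ((even_two).pow_of_ne_zero hn.ne'))
      have := hp.two_le
      omega
    obtain ⟨a, rfl⟩ : ∃ a, n = a + 1 := ⟨n - 1, by omega⟩
    obtain ⟨q, rfl⟩ : ∃ q, p = q + 1 := ⟨p - 1, by omega⟩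
    rw [Nat.totient_prime_pow_succ hp, Nat.add_sub_cancel, mul_pow, pow_succ]
    refine Nat.mul_le_mul ?_ (by nlinarith)
    exact Nat.le_self_pow two_ne_zero _
  | coprime a b ha hb hab iha ihb =>
    rw [Nat.totient_mul hab, mul_pow]
    exact Nat.mul_le_mul (iha (Nat.Odd.of_mul_left hk)) (ihb (Nat.Odd.of_mul_right hk))

theorem le_two_mul_totient_sq (k : ℕ) : k ≤ 2 * k.totient ^ 2 := by
  rcases eq_or_ne k 0 with rfl | hk
  · simp
  obtain ⟨a, m, hm, rfl⟩ := Nat.exists_eq_two_pow_mul_odd hk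
  have h := le_totient_sq_of_odd hm
  rcases a with _ | a
  · rw [pow_zero, one_mul]; omega
  · rw [Nat.totient_mul (Nat.Coprime.pow_left _ (Nat.coprime_two_left.mpr hm)),
      Nat.totient_prime_pow_succ Nat.prime_two, mul_pow, ← mul_assoc]
    refine Nat.mul_le_mul ?_ h
    have := Nat.le_self_pow two_ne_zero (2 ^ a)
    simp only [pow_succ, Nat.add_one_sub_one, mul_one] at *
    omega

/-- The term of the density series as it would be if all the degrees were `φ(k) |Γ(k)|`. -/
def genericTerm (Γ : Subgroup ℚˣ) (t : ℝ) (k : ℕ) : ℝ :=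
  jordan t k * (rad k : ℝ) ^ t * (-1) ^ k.primeFactors.card /
    ((k : ℝ) ^ (2 * t) * (k.totient * Nat.card (GammaMod Γ k) : ℝ))

variable {Γ : Subgroup ℚˣ} {t : ℝ}

theorem genericTerm_zero (ht : 0 < t) : genericTerm Γ t 0 = 0 := by
  simp [genericTerm, jordan, Real.zero_rpow ht.ne']

theorem genericTerm_one : genericTerm Γ t 1 = 1 := by
  simp [genericTerm, jordan, rad, card_GammaMod_one]

theorem genericTerm_mul {m n : ℕ} (h : m.Coprime n) :
    genericTerm Γ t (m * n) = genericTerm Γ t m * genericTerm Γ t n := by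
  have hr : rad (m * n) = rad m * rad n := by
    rw [rad, h.primeFactors_mul, Finset.prod_union h.disjoint_primeFactors]; rfl
  have hj : jordan t (m * n) = jordan t m * jordan t n := by
    rw [jordan, h.primeFactors_mul, Finset.prod_union h.disjoint_primeFactors, Nat.cast_mul,
      Real.mul_rpow (Nat.cast_nonneg _) (Nat.cast_nonneg _), jordan, jordan]
    ring
  rw [genericTerm, hr, hj, h.primeFactors_mul, Finset.card_union_of_disjoint
    h.disjoint_primeFactors, Nat.totient_mul h, card_GammaMod_mul Γ h, pow_add]
  push_cast
  rw [Real.mul_rpow (Nat.cast_nonneg _) (Nat.cast_nonneg _),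
    Real.mul_rpow (Nat.cast_nonneg _) (Nat.cast_nonneg _), genericTerm, genericTerm,
    div_mul_div_comm]
  congr 1 <;> ring

theorem rpow_mul_natCast_add {p : ℝ} (hp : 0 < p) (t : ℝ) (a : ℕ) :
    p ^ ((a : ℝ) * (t + 1) - 1) = (p ^ t) ^ a * p ^ a / p := by
  rw [Real.rpow_sub hp, Real.rpow_one, mul_add, mul_one, Real.rpow_add hp, Real.rpow_natCast,
    mul_comm (a : ℝ) t, Real.rpow_mul hp.le, Real.rpow_natCast]

theorem genericTerm_prime_pow {p : ℕ} (hp : p.Prime) {a : ℕ} (ha : 1 ≤ a) :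
    genericTerm Γ t (p ^ a) = -localTerm Γ t p a := by
  obtain ⟨b, rfl⟩ : ∃ b, a = b + 1 := ⟨a - 1, by omega⟩
  have hp0 : (0 : ℝ) < p := Nat.cast_pos.mpr hp.pos
  have hX : (0 : ℝ) < (p : ℝ) ^ t := Real.rpow_pos_of_pos hp0 t
  have hpf : (p ^ (b + 1)).primeFactors = {p} := Nat.primeFactors_prime_pow (by omega) hp
  have h1 : (1 : ℝ) ≤ p := by exact_mod_cast hp.one_lt.le
  have e1 : (((p ^ (b + 1) : ℕ) : ℝ)) ^ t = ((p : ℝ) ^ t) ^ (b + 1) := by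
    rw [Nat.cast_pow, ← Real.rpow_natCast, ← Real.rpow_mul hp0.le, mul_comm,
      Real.rpow_mul hp0.le, Real.rpow_natCast]
  have e2 : (((p ^ (b + 1) : ℕ) : ℝ)) ^ (2 * t) = (((p : ℝ) ^ t) ^ (b + 1)) ^ 2 := by
    rw [mul_comm, Real.rpow_mul (Nat.cast_nonneg _), e1, Real.rpow_two]
  rw [genericTerm, jordan, rad, hpf, Finset.prod_singleton, Finset.prod_singleton,
    Finset.card_singleton, e1, e2, Nat.totient_prime_pow_succ hp, localTerm,
    rpow_mul_natCast_add hp0]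
  push_cast [Nat.cast_sub hp.one_lt.le]
  rw [pow_succ (p : ℝ) b]
  set X := (p : ℝ) ^ t
  set N : ℝ := (Nat.card (GammaMod Γ (p ^ (b + 1))) : ℝ)
  set Y := X ^ b with hY
  have hY0 : Y ≠ 0 := pow_ne_zero _ hX.ne'
  have hZ0 : (p : ℝ) ^ b ≠ 0 := pow_ne_zero _ hp0.ne'
  rw [pow_succ X b, ← hY]
  have hpm : (p : ℝ) - 1 ≠ 0 := by
    have : (1 : ℝ) < p := by exact_mod_cast hp.one_lt
    linarith
  -- Without finite generation `Nat.card` may be 0; both sides then vanish by division by zero.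
  by_cases hN : N = 0
  · simp [hN]
  field_simp

theorem norm_genericTerm_le (hfg : Γ.FG) (ht : 0 < t) {k : ℕ} (hk : k ≠ 0) :
    ‖genericTerm Γ t k‖ ≤ 1 / ((k.totient : ℝ) * Nat.card (GammaMod Γ k)) := by
  have hk0 : (0 : ℝ) < k := Nat.cast_pos.mpr (Nat.pos_of_ne_zero hk)
  have hkt : (0 : ℝ) < (k : ℝ) ^ t := Real.rpow_pos_of_pos hk0 t
  have hN : (0 : ℝ) < Nat.card (GammaMod Γ k) := Nat.cast_pos.mpr (card_GammaMod_pos hfg hk)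
  have hφ : (0 : ℝ) < k.totient := Nat.cast_pos.mpr (Nat.totient_pos.mpr (Nat.pos_of_ne_zero hk))
  have hprod : ∀ l ∈ k.primeFactors, 0 ≤ (1 - 1 / (l : ℝ) ^ t) ∧ (1 - 1 / (l : ℝ) ^ t) ≤ 1 := by
    intro l hl
    have hl1 : (1 : ℝ) ≤ l := by exact_mod_cast (Nat.prime_of_mem_primeFactors hl).one_lt.le
    have h1 := Real.one_le_rpow hl1 ht.le
    have h2 : 1 / (l : ℝ) ^ t ≤ 1 := by rw [div_le_one (by linarith)]; exact h1
    have h3 : 0 ≤ 1 / (l : ℝ) ^ t := by positivity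
    constructor <;> linarith
  have hj0 : 0 ≤ jordan t k :=
    mul_nonneg hkt.le (Finset.prod_nonneg fun l hl => (hprod l hl).1)
  have hj1 : jordan t k ≤ (k : ℝ) ^ t :=
    mul_le_of_le_one_right hkt.le (Finset.prod_le_one (fun l hl => (hprod l hl).1)
      fun l hl => (hprod l hl).2)
  have hr1 : (rad k : ℝ) ^ t ≤ (k : ℝ) ^ t :=
    Real.rpow_le_rpow (Nat.cast_nonneg _) (Nat.cast_le.mpr
      (Nat.le_of_dvd (Nat.pos_of_ne_zero hk) (Nat.prod_primeFactors_dvd k))) ht.le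
  have hr0 : 0 ≤ (rad k : ℝ) ^ t := Real.rpow_nonneg (Nat.cast_nonneg _) _
  have h2t : (k : ℝ) ^ (2 * t) = (k : ℝ) ^ t * (k : ℝ) ^ t := by
    rw [two_mul, Real.rpow_add hk0]
  rw [genericTerm, norm_div, norm_mul, norm_mul, norm_pow, norm_neg, norm_one, one_pow, mul_one,
    Real.norm_of_nonneg hj0, Real.norm_of_nonneg hr0, Real.norm_of_nonneg (by positivity), h2t,
    ← div_div]
  gcongr
  rw [div_le_one (by positivity)]
  exact mul_le_mul hj1 hr1 hr0 hkt.le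

theorem summable_genericTerm (hfg : Γ.FG) (hpos : ∀ g ∈ Γ, 0 < (g : ℚ)) (hne : Γ ≠ ⊥)
    (ht : 0 < t) : Summable (genericTerm Γ t) := by
  obtain ⟨n, hn⟩ := exists_le_mul_card_GammaMod hfg hpos hne
  -- The exponent is 1 from the growth of $|\Gamma(k)|$ plus 1/2 from $\varphi(k)$.
  have hs := (Real.summable_one_div_nat_rpow (p := 3 / 2)).mpr (by norm_num)
  refine Summable.of_norm_bounded (hs.mul_left (2 * n : ℝ)) fun k => ?_
  rcases eq_or_ne k 0 with rfl | hk
  · rw [genericTerm_zero ht]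
    simp
  refine (norm_genericTerm_le hfg ht hk).trans ?_
  have hk0 : (0 : ℝ) < k := Nat.cast_pos.mpr (Nat.pos_of_ne_zero hk)
  have hN : (0 : ℝ) < Nat.card (GammaMod Γ k) := Nat.cast_pos.mpr (card_GammaMod_pos hfg hk)
  have hφ : (0 : ℝ) < k.totient := Nat.cast_pos.mpr (Nat.totient_pos.mpr (Nat.pos_of_ne_zero hk))
  have h1 : (k : ℝ) ≤ n * Nat.card (GammaMod Γ k) := by exact_mod_cast hn k hk
  have h2 : Real.sqrt k ≤ 2 * k.totient := by
    rw [Real.sqrt_le_left (by positivity)]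
    have : (k : ℝ) ≤ 2 * (k.totient : ℝ) ^ 2 := by exact_mod_cast le_two_mul_totient_sq k
    nlinarith [sq_nonneg (k.totient : ℝ)]
  have h3 : (k : ℝ) ^ (3 / 2 : ℝ) = k * Real.sqrt k := by
    rw [show (3 / 2 : ℝ) = 1 + 1 / 2 by norm_num, Real.rpow_add hk0, Real.rpow_one,
      Real.sqrt_eq_rpow]
  have hs0 : 0 < Real.sqrt k := Real.sqrt_pos.mpr hk0
  rw [h3, mul_one_div, div_le_div_iff₀ (by positivity) (by positivity), one_mul]
  calc (k : ℝ) * Real.sqrt k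
      ≤ (n * Nat.card (GammaMod Γ k)) * (2 * k.totient) := mul_le_mul h1 h2 hs0.le (by positivity)
    _ = _ := by ring

theorem localTerm_pos (hfg : Γ.FG) (ht : 0 < t) {p : ℕ} (hp : p.Prime) (a : ℕ) :
    0 < localTerm Γ t p a := by
  have hp1 : (1 : ℝ) < p := by exact_mod_cast hp.one_lt
  have hN : (0 : ℝ) < Nat.card (GammaMod Γ (p ^ a)) :=
    Nat.cast_pos.mpr (card_GammaMod_pos hfg (pow_ne_zero _ hp.ne_zero))
  have hX := Real.one_lt_rpow hp1 ht
  have h0 : (0 : ℝ) < (p : ℝ) ^ ((a : ℝ) * (t + 1) - 1) :=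
    Real.rpow_pos_of_pos (by linarith) _
  exact div_pos (by linarith) (mul_pos (mul_pos h0 hN) (by linarith))

theorem summable_localTerm (hfg : Γ.FG) (hpos : ∀ g ∈ Γ, 0 < (g : ℚ)) (hne : Γ ≠ ⊥)
    (ht : 0 < t) {p : ℕ} (hp : p.Prime) :
    Summable fun α : {α : ℕ // 1 ≤ α} => localTerm Γ t p α := by
  have h := summable_comp_prime_pow (summable_genericTerm hfg hpos hne ht) hp
  have h := (h.comp_injective (Subtype.val_injective (p := fun α : ℕ => 1 ≤ α))).neg
  refine h.congr fun α => ?_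
  simp [genericTerm_prime_pow hp α.2]

theorem localSum_pos (hfg : Γ.FG) (hpos : ∀ g ∈ Γ, 0 < (g : ℚ)) (hne : Γ ≠ ⊥) (ht : 0 < t)
    {p : ℕ} (hp : p.Prime) : 0 < localSum Γ t p :=
  (summable_localTerm hfg hpos hne ht hp).tsum_pos (fun α => (localTerm_pos hfg ht hp α).le)
    ⟨1, le_rfl⟩ (localTerm_pos hfg ht hp 1)

theorem tsum_one_le_eq {g : ℕ → ℝ} :
    ∑' α : {α : ℕ // 1 ≤ α}, g α = ∑' n : ℕ, g (n + 1) := by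
  let e : ℕ ≃ {α : ℕ // 1 ≤ α} :=
    { toFun := fun n => ⟨n + 1, by omega⟩
      invFun := fun α => α - 1
      left_inv := fun n => by simp
      right_inv := fun α => Subtype.ext (by have := α.2; simp only; omega) }
  exact (e.tsum_eq fun α : {α : ℕ // 1 ≤ α} => g α).symm

/-- With only $|\Gamma(p^\alpha)|\ge1$ and $X=p^t$, a geometric series bounds $F_p$ by
$(X-1)p/((p-1)(pX-1))$. -/
theorem localSum_lt_one (hfg : Γ.FG) (hpos : ∀ g ∈ Γ, 0 < (g : ℚ)) (hne : Γ ≠ ⊥) (ht : 0 < t)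
    {p : ℕ} (hp : p.Prime) : localSum Γ t p < 1 := by
  have hs := summable_localTerm hfg hpos hne ht hp
  have hp2 : (2 : ℝ) ≤ p := by exact_mod_cast hp.two_le
  have hX : 1 < (p : ℝ) ^ t := Real.one_lt_rpow (by linarith) ht
  set X := (p : ℝ) ^ t with hXdef
  have hpX : 1 < (p : ℝ) * X := by nlinarith
  have hr1 : ((p : ℝ) * X)⁻¹ < 1 := inv_lt_one_of_one_lt₀ hpX
  have hr0 : 0 ≤ ((p : ℝ) * X)⁻¹ := by positivity
  have hgeo := hasSum_geometric_of_lt_one hr0 hr1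
  have hbound : ∀ n : ℕ, localTerm Γ t p (n + 1) ≤
      (X - 1) / (X * (p - 1)) * ((p : ℝ) * X)⁻¹ ^ n := fun n => by
    have hN : (1 : ℝ) ≤ Nat.card (GammaMod Γ (p ^ (n + 1))) := by
      exact_mod_cast card_GammaMod_pos hfg (pow_ne_zero _ hp.ne_zero)
    rw [localTerm, rpow_mul_natCast_add (by linarith), ← hXdef, inv_pow, ← div_eq_mul_inv, div_div,
      mul_pow]
    have hp1 : (0 : ℝ) < p - 1 := by linarith
    have hX1 : 0 < X - 1 := by linarith
    refine div_le_div_of_nonneg_left hX1.le (by positivity) ?_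
    have e : X ^ (n + 1) * (p : ℝ) ^ (n + 1) / p = X * (p ^ n * X ^ n) := by
      field_simp
      ring
    rw [e]
    have : 0 < X * ((p : ℝ) ^ n * X ^ n) * (p - 1) := by positivity
    nlinarith
  have hs' : Summable fun n : ℕ => localTerm Γ t p (n + 1) :=
    hs.comp_injective (i := fun n : ℕ => (⟨n + 1, by omega⟩ : {α : ℕ // 1 ≤ α}))
      fun a b h => by simpa using h
  have hle := hs'.tsum_le_tsum hbound (hgeo.summable.mul_left _)
  rw [tsum_mul_left, hgeo.tsum_eq] at hle
  rw [localSum, tsum_one_le_eq]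
  refine lt_of_le_of_lt hle ?_
  have hp1 : (0 : ℝ) < p - 1 := by linarith
  have hq : 0 < (p : ℝ) * X - 1 := by linarith
  have hX0 : X ≠ 0 := by positivity
  have hp0 : (p : ℝ) ≠ 0 := by positivity
  have e : (X - 1) / (X * (p - 1)) * (1 - ((p : ℝ) * X)⁻¹)⁻¹ =
      (X - 1) * p / ((p - 1) * (p * X - 1)) := by
    have : 1 - ((p : ℝ) * X)⁻¹ = (p * X - 1) / (p * X) := by field_simp
    rw [this, inv_div]
    field_simp
  rw [e, div_lt_one (by positivity)]
  -- Denominator minus numerator is $pX(p-2)+1>0$.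
  nlinarith [mul_nonneg (mul_nonneg (sub_nonneg.mpr hp2) (by positivity : (0:ℝ) ≤ p))
    (by positivity : (0:ℝ) ≤ X)]

theorem localFactor_genericTerm (hfg : Γ.FG) (hpos : ∀ g ∈ Γ, 0 < (g : ℚ)) (hne : Γ ≠ ⊥)
    (ht : 0 < t) {p : ℕ} (hp : p.Prime) :
    localFactor (genericTerm Γ t) p = 1 - localSum Γ t p := by
  have h := summable_comp_prime_pow (summable_genericTerm hfg hpos hne ht) hp
  rw [localFactor, h.tsum_eq_zero_add, localSum, tsum_one_le_eq, pow_zero, genericTerm_one,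
    sub_eq_add_neg, ← tsum_neg]
  congr 1
  exact tsum_congr fun n => genericTerm_prime_pow hp (by omega)

theorem localTail_genericTerm {p : ℕ} (hp : p.Prime) {γ : ℕ∞} (hγ : 1 ≤ γ) :
    localTail (genericTerm Γ t) p γ =
      -∑' α : {α : ℕ // γ ≤ (α : ℕ∞)}, localTerm Γ t p α := by
  classical
  have h := tsum_subtype {α : ℕ | γ ≤ (α : ℕ∞)} fun α => localTerm Γ t p α
  change _ = -(∑' α : ({α : ℕ | γ ≤ (α : ℕ∞)} : Set ℕ), localTerm Γ t p α)
  rw [h, localTail, ← tsum_neg]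
  refine tsum_congr fun e => ?_
  by_cases he : γ ≤ (e : ℕ∞)
  · rw [if_pos he, Set.indicator_of_mem (by exact he), genericTerm_prime_pow hp]
    exact_mod_cast hγ.trans he
  · rw [if_neg he, Set.indicator_of_notMem (by exact he), neg_zero]

theorem localTail_genericTerm_one {p : ℕ} (hp : p.Prime) :
    localTail (genericTerm Γ t) p 1 = -localSum Γ t p := by
  rw [localTail_genericTerm hp le_rfl]
  rw [localSum, ← (Equiv.subtypeEquivRight (p := fun α : ℕ => 1 ≤ α)
    (q := fun α : ℕ => (1 : ℕ∞) ≤ (α : ℕ∞)) fun α => by exact_mod_cast Iff.rfl).tsum_eq]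
  rfl

theorem localTerm_two (α : ℕ) : localTerm Γ t 2 α = twoTerm Γ t α := by
  rw [localTerm, twoTerm]
  norm_num

/-- At $p=2$ the factor $p-1$ is 1, so the denominator of $S_\eta$ is $F_2$. -/
theorem localTail_genericTerm_two (hF : localSum Γ t 2 ≠ 0) (η : ℤ) :
    localTail (genericTerm Γ t) 2 (gammaExp Γ η) = -(S Γ t η * localSum Γ t 2) := by
  rw [localTail_genericTerm Nat.prime_two (one_le_gammaExp Γ η), S]
  simp only [localSum, localTerm_two] at hF ⊢
  rw [div_mul_cancel₀ _ hF]

end KummerDensity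
end

/-! ### Summation over the entangled divisors. -/

noncomputable section
namespace KummerDensity

variable {Γ : Subgroup ℚˣ} {t : ℝ}

theorem densityTerm_eq (hfg : Γ.FG) (hpos : ∀ g ∈ Γ, 0 < (g : ℚ)) (k : ℕ+) :
    densityTerm Γ t k = genericTerm Γ t k * (entangledDivisors Γ k).card := by
  have hdeg := finrank_kummerField_mul_card hfg hpos k.ne_zero
  have hE : (entangledDivisors Γ k).card ≠ 0 := by
    refine Finset.card_ne_zero_of_mem (a := 1) ?_
    exact mem_entangledDivisors.mpr ⟨⟨one_dvd _, (squarefree_sigma hfg).ne_zero⟩, Or.inl rfl⟩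
  have hE : ((entangledDivisors Γ k).card : ℝ) ≠ 0 := Nat.cast_ne_zero.mpr hE
  have h : (((k : ℕ).totient : ℝ) * Nat.card (GammaMod Γ k)) =
      Module.finrank ℚ (kummerField Γ k) * (entangledDivisors Γ k).card := by
    exact_mod_cast hdeg.symm
  rw [densityTerm, genericTerm, h, ← mul_assoc, div_mul_eq_mul_div, mul_div_mul_right _ _ hE]

open Classical in
/-- The threshold at `p` in the condition `Meets Γ k η`. -/
def threshold (Γ : Subgroup ℚˣ) (η p : ℕ) : ℕ∞ := if p = 2 then gammaExp Γ η else 1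

theorem one_le_threshold (Γ : Subgroup ℚˣ) (η p : ℕ) : 1 ≤ threshold Γ η p := by
  unfold threshold
  split_ifs
  · exact one_le_gammaExp Γ η
  · exact le_rfl

/-- Puts the condition prime by prime, in the form that `tsum_mul_prod_ite` requires. -/
theorem meets_iff {k η : ℕ} (hk : k ≠ 0) (hη : η ≠ 0) :
    Meets Γ k η ↔ ∀ p ∈ (2 * η).primeFactors, threshold Γ η p ≤ (padicValNat p k : ℕ∞) := by
  have h2 : 2 ∈ (2 * η).primeFactors :=
    Nat.mem_primeFactors.mpr ⟨Nat.prime_two, dvd_mul_right _ _, mul_ne_zero two_ne_zero hη⟩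
  constructor
  · rintro ⟨h, hd⟩ p hp
    unfold threshold
    split_ifs with hp2
    · rwa [hp2]
    · have : Fact p.Prime := ⟨Nat.prime_of_mem_primeFactors hp⟩
      exact_mod_cast one_le_padicValNat_of_dvd hk (hd p hp)
  · intro h
    refine ⟨by simpa [threshold] using h 2 h2, fun p hp => ?_⟩
    have h1 := (one_le_threshold Γ η p).trans (h p hp)
    exact dvd_of_one_le_padicValNat (by exact_mod_cast h1)

open Classical in
/-- The contribution of `η` to the `k`-th term of the density series. -/
def entangledTerm (Γ : Subgroup ℚˣ) (t : ℝ) (η k : ℕ) : ℝ :=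
  if η = 1 ∨ Meets Γ k η then genericTerm Γ t k else 0

theorem genericTerm_mul_card (k : ℕ) :
    genericTerm Γ t k * (entangledDivisors Γ k).card =
      ∑ η ∈ (sigma Γ).divisors, entangledTerm Γ t η k := by
  classical
  simp only [entangledTerm, entangledDivisors]
  rw [← Finset.sum_filter, Finset.sum_const, nsmul_eq_mul, mul_comm]

theorem summable_entangledTerm (hfg : Γ.FG) (hpos : ∀ g ∈ Γ, 0 < (g : ℚ)) (hne : Γ ≠ ⊥)
    (ht : 0 < t) (η : ℕ) : Summable (entangledTerm Γ t η) := by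
  refine Summable.of_norm_bounded (summable_genericTerm hfg hpos hne ht).norm fun k => ?_
  unfold entangledTerm
  split_ifs <;> simp

theorem tsum_entangledTerm (hfg : Γ.FG) (hpos : ∀ g ∈ Γ, 0 < (g : ℚ)) (hne : Γ ≠ ⊥)
    (ht : 0 < t) {η : ℕ} (hη0 : η ≠ 0) (hη1 : η ≠ 1) :
    ∑' k, entangledTerm Γ t η k = (∑' k, genericTerm Γ t k) *
      (S Γ t η * ∏ p ∈ (2 * η).primeFactors, (1 - (localSum Γ t p)⁻¹)⁻¹) := by
  classical
  have hprime : ∀ p ∈ (2 * η).primeFactors, p.Prime := fun p hp => Nat.prime_of_mem_primeFactors hp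
  have hF : ∀ p : ℕ, p.Prime → 0 < localSum Γ t p ∧ localSum Γ t p < 1 := fun p hp =>
    ⟨localSum_pos hfg hpos hne ht hp, localSum_lt_one hfg hpos hne ht hp⟩
  have hfac : ∀ p : ℕ, p.Prime → localFactor (genericTerm Γ t) p = 1 - localSum Γ t p :=
    fun p hp => localFactor_genericTerm hfg hpos hne ht hp
  have h := tsum_mul_prod_ite genericTerm_one genericTerm_mul
    (summable_genericTerm hfg hpos hne ht) (genericTerm_zero ht) _ hprime (threshold Γ η)
    (one_le_threshold Γ η) (fun p hp => by
      rw [hfac p (hprime p hp)]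
      linarith [(hF p (hprime p hp)).2])
  have e : ∀ k, entangledTerm Γ t η k = genericTerm Γ t k * ∏ p ∈ (2 * η).primeFactors,
      (if threshold Γ η p ≤ (padicValNat p k : ℕ∞) then (1 : ℝ) else 0) := by
    intro k
    rcases eq_or_ne k 0 with rfl | hk
    · simp [entangledTerm, genericTerm_zero ht]
    rw [entangledTerm, Finset.prod_ite_zero, Finset.prod_const_one]
    simp only [hη1, false_or, meets_iff hk hη0, mul_ite, mul_one, mul_zero]
  rw [tsum_congr e, h]
  congr 1
  have h2 : 2 ∈ (2 * η).primeFactors :=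
    Nat.mem_primeFactors.mpr ⟨Nat.prime_two, dvd_mul_right _ _, mul_ne_zero two_ne_zero hη0⟩
  rw [← Finset.mul_prod_erase _ _ h2, ← Finset.mul_prod_erase _ _ h2, ← mul_assoc]
  -- Tail over full factor: this is the whole ratio at odd $p$, and at 2 it is multiplied by
  -- $S_\eta$.
  have hratio : ∀ x : ℝ, 0 < x → x < 1 → -x / (1 - x) = (1 - x⁻¹)⁻¹ := fun x h0 h1 => by
    have : 1 - x⁻¹ = (x - 1) / x := by field_simp
    rw [this, inv_div, ← neg_sub x 1, neg_div_neg_eq]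
  congr 1
  · rw [hfac 2 Nat.prime_two, ← hratio _ (hF 2 Nat.prime_two).1 (hF 2 Nat.prime_two).2,
      threshold, if_pos rfl, localTail_genericTerm_two (hF 2 Nat.prime_two).1.ne']
    ring
  · refine Finset.prod_congr rfl fun p hp => ?_
    obtain ⟨hp2, hp⟩ := Finset.mem_erase.mp hp
    have hp := hprime p hp
    rw [threshold, if_neg hp2, hfac p hp, localTail_genericTerm_one hp,
      hratio _ (hF p hp).1 (hF p hp).2]

theorem hasProd_one_sub_localSum (hfg : Γ.FG) (hpos : ∀ g ∈ Γ, 0 < (g : ℚ)) (hne : Γ ≠ ⊥)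
    (ht : 0 < t) :
    HasProd (fun p : Nat.Primes => 1 - localSum Γ t p) (∑' k, genericTerm Γ t k) := by
  have h := EulerProduct.eulerProduct_hasProd (genericTerm_one (Γ := Γ) (t := t)) genericTerm_mul
    (summable_genericTerm hfg hpos hne ht).norm (genericTerm_zero ht)
  have e : (fun p : Nat.Primes => 1 - localSum Γ t p) =
      fun p : Nat.Primes => ∑' e, genericTerm Γ t ((p : ℕ) ^ e) :=
    funext fun p => (localFactor_genericTerm hfg hpos hne ht p.2).symm
  rwa [e]

end KummerDensity
end

theorem theorem2 (Γ : Subgroup ℚˣ) (hfg : Γ.FG) (hpos : ∀ g ∈ Γ, 0 < (g : ℚ)) (hne : Γ ≠ ⊥)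
    (t : ℝ) (ht : 0 < t) :
    Summable (KummerDensity.densityTerm Γ t) ∧
    (∀ p : ℕ, p.Prime →
      Summable (fun α : {α : ℕ // 1 ≤ α} => KummerDensity.localTerm Γ t p α) ∧
      0 < KummerDensity.localSum Γ t p ∧ KummerDensity.localSum Γ t p < 1) ∧
    Multipliable (fun p : Nat.Primes => 1 - KummerDensity.localSum Γ t p) ∧
    KummerDensity.densityConst Γ t =
      (∏' p : Nat.Primes, (1 - KummerDensity.localSum Γ t p)) *
        (1 + ∑ η ∈ (KummerDensity.sigma Γ).divisors.erase 1,
          KummerDensity.S Γ t η *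
            ∏ p ∈ (2 * η).primeFactors, (1 - (KummerDensity.localSum Γ t p)⁻¹)⁻¹) := by
  have hterm : ∀ k : ℕ+, KummerDensity.densityTerm Γ t k =
      ∑ η ∈ (KummerDensity.sigma Γ).divisors, KummerDensity.entangledTerm Γ t η k := fun k => by
    rw [KummerDensity.densityTerm_eq hfg hpos, KummerDensity.genericTerm_mul_card]
  have hsum := KummerDensity.summable_entangledTerm hfg hpos hne ht
  have hprod := KummerDensity.hasProd_one_sub_localSum hfg hpos hne ht
  have hall : Summable fun k : ℕ => ∑ η ∈ (KummerDensity.sigma Γ).divisors,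
      KummerDensity.entangledTerm Γ t η k := summable_sum fun η _ => hsum η
  refine ⟨?_, fun p hp => ⟨KummerDensity.summable_localTerm hfg hpos hne ht hp,
    KummerDensity.localSum_pos hfg hpos hne ht hp,
    KummerDensity.localSum_lt_one hfg hpos hne ht hp⟩, hprod.multipliable, ?_⟩
  · exact (hall.comp_injective PNat.coe_injective).congr fun k => (hterm k).symm
  · rw [KummerDensity.densityConst, tsum_congr hterm, hprod.tprod_eq]
    -- The generic term vanishes at $k=0$, so the sum over $\mathbb{N}$, to which Euler products
    -- apply, agrees with the sum over $k\ge1$.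
    have hsupp : Function.support (fun k : ℕ => ∑ η ∈ (KummerDensity.sigma Γ).divisors,
        KummerDensity.entangledTerm Γ t η k) ⊆ Set.range ((↑) : ℕ+ → ℕ) := by
      intro k hk
      refine ⟨⟨k, Nat.pos_of_ne_zero ?_⟩, rfl⟩
      rintro rfl
      exact hk (Finset.sum_eq_zero fun η _ => by
        simp [KummerDensity.entangledTerm, KummerDensity.genericTerm_zero ht])
    rw [PNat.coe_injective.tsum_eq hsupp, Summable.tsum_finsetSum fun η _ => hsum η]
    have hσ := (KummerDensity.squarefree_sigma hfg).ne_zero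
    rw [← Finset.add_sum_erase _ _ (Nat.mem_divisors.mpr ⟨one_dvd _, hσ⟩), mul_add, mul_one,
      Finset.mul_sum]
    have hone : KummerDensity.entangledTerm Γ t 1 = KummerDensity.genericTerm Γ t :=
      funext fun k => if_pos (Or.inl rfl)
    rw [hone]
    refine congrArg _ (Finset.sum_congr rfl fun η hη => ?_)
    obtain ⟨hη1, hη⟩ := Finset.mem_erase.mp hη
    exact KummerDensity.tsum_entangledTerm hfg hpos hne ht (Nat.pos_of_mem_divisors hη).ne' hη1
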